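/- Consider fractional online bipartite matching with two-sided vertex arrivals: the vertices of an unknown finite bipartite graph $G=(L\cup R,E)$ arrive one at a time in an arbitrary order. Upon its arrival, a vertex reveals its side and its edges to the previously arrived vertices, and the algorithm must irrevocably choose values $x_{uv}\ge 0$ for these edges such that $x_v=\sum_{u:(u,v)\in E}x_{uv}\le 1$ for every vertex $v$ at all times. A deterministic algorithm is $\Gamma$-competitive if on every instance $\frac12\sum_v x_v$ is at least $\Gamma$ times the size of a maximum (integral) matching of $G$. A randomized algorithm is $\Gamma$-competitive if on every instance, fixed independently of its random choices, the expectation of $\frac12\sum_v x_v$ is at least $\Gamma$ times that size. Let $$\Gamma^* := \max_{k\ge 1}\ \frac{1}{\left(\frac{k+1}{2}\right)^{\frac{k+1}{2k}}\left(\frac{k-1}{2}\right)^{\frac{k-1}{2k}}+1},$$ where $k$ ranges over the real numbers and $0^0=1$. This maximum is attained, and $|\Gamma^*-0.526|<0.0005$. For every constant $c>0$, no algorithm, deterministic or randomized, is $(\Gamma^*+c)$-competitive. -/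

import Mathlib

open MeasureTheory

/-- An input of the online problem with `n` vertices: a bipartite graph whose vertices are listed in
their order of arrival (vertex `i` is the `i`-th to arrive), with its two sides. -/
structure Instance (n : ℕ) where
  graph : SimpleGraph (Fin n)
  side : Fin n → Bool
  bipartite : ∀ ⦃u v : Fin n⦄, graph.Adj u v → side u ≠ side v

/-- What has been revealed once the first `m` vertices have arrived: the subgraph that they induce,
and their sides. -/
def Instance.firstArrivals {n : ℕ} (I : Instance n) (m : ℕ) (h : m ≤ n) : Instance m where
  graph := I.graph.comap (Fin.castLE h)
  side := fun u => I.side (Fin.castLE h u)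
  bipartite := fun _ _ huv => I.bipartite huv

/-- `IsFractionalMatching G x`: the symmetric matrix `x` assigns to the edges of `G` nonnegative
values whose sum around any vertex is at most one. -/
structure IsFractionalMatching {V : Type*} [Fintype V] (G : SimpleGraph V) (x : V → V → ℝ) :
    Prop where
  symm : ∀ u v, x u v = x v u
  nonneg : ∀ u v, 0 ≤ x u v
  eq_zero : ∀ u v, ¬ G.Adj u v → x u v = 0
  sum_le_one : ∀ v, ∑ u, x u v ≤ 1

/-- The sizes of the (integral) matchings of a graph. -/
def matchingSizes {V : Type*} (G : SimpleGraph V) : Set ℕ :=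
  {m | ∃ M : G.Subgraph, M.IsMatching ∧ M.edgeSet.ncard = m}

/-- The size of a maximum matching of a finite graph. -/
noncomputable def maxMatchingSize {V : Type*} [Finite V] (G : SimpleGraph V) : ℕ :=
  sSup (matchingSizes G)

theorem isGreatest_maxMatchingSize {V : Type*} [Finite V] (G : SimpleGraph V) :
    IsGreatest (matchingSizes G) (maxMatchingSize G) := by
  have hb : BddAbove (matchingSizes G) := by
    refine ⟨Nat.card (Sym2 V), ?_⟩
    rintro m ⟨M, -, rfl⟩
    exact Set.ncard_le_card M.edgeSet
  have hne : (matchingSizes G).Nonempty := ⟨0, ⊥, fun v hv => absurd hv (by simp), by simp⟩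
  exact ⟨Nat.sSup_mem hne hb, fun m hm => le_csSup hb hm⟩

/-- A decision rule for arrivals. When the vertex number `t` arrives (so that vertices `0, …, t`
are present), it sees everything revealed so far and chooses the value of each edge between the new
vertex `t` and an earlier vertex `u`. These values are never revised. -/
abbrev DecisionRule : Type := (t : ℕ) → Instance (t + 1) → Fin t → ℝ

/-- The values `x u v` that a decision rule produces on an input: the pair `{u, v}` gets the value
chosen at the arrival of the later of the two vertices. -/
noncomputable def DecisionRule.output (D : DecisionRule) {n : ℕ} (I : Instance n)
    (u v : Fin n) : ℝ :=
  if h : u < v then D v (I.firstArrivals (v + 1) v.isLt) ⟨u, h⟩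
  else if h : v < u then D u (I.firstArrivals (u + 1) u.isLt) ⟨v, h⟩
  else 0

/-- A deterministic online algorithm for fractional bipartite matching with two-sided vertex
arrivals: a decision rule that produces a fractional matching on every input. -/
structure OnlineAlgorithm where
  rule : DecisionRule
  feasible : ∀ (n : ℕ) (I : Instance n), IsFractionalMatching I.graph (rule.output I)

/-- The size of the fractional matching that the algorithm produces: half of the sum over all
vertices of their matched portions. -/
noncomputable def OnlineAlgorithm.size (A : OnlineAlgorithm) {n : ℕ} (I : Instance n) : ℝ :=
  (∑ v, ∑ u, A.rule.output I u v) / 2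

/-- The algorithm is `Γ`-competitive: on every input it obtains at least a `Γ` fraction of the
size of an offline maximum matching. -/
def OnlineAlgorithm.IsCompetitive (A : OnlineAlgorithm) (Γ : ℝ) : Prop :=
  ∀ (n : ℕ) (I : Instance n), Γ * (maxMatchingSize I.graph : ℝ) ≤ A.size I

/-- A randomized online algorithm with random seed in `Ω`: a deterministic algorithm for each
seed, each decision of which is a random variable. -/
structure RandomizedAlgorithm (Ω : Type*) [MeasurableSpace Ω] where
  alg : Ω → OnlineAlgorithm
  measurable_rule : ∀ (t : ℕ) (I : Instance (t + 1)) (u : Fin t),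
    Measurable fun ω => (alg ω).rule t I u

/-- A randomized algorithm, with seed drawn from `μ`, is `Γ`-competitive: on every input (fixed
independently of the seed), its expected size is at least a `Γ` fraction of the size of an offline
maximum matching. -/
def RandomizedAlgorithm.IsCompetitive {Ω : Type*} [MeasurableSpace Ω] (R : RandomizedAlgorithm Ω)
    (μ : Measure Ω) (Γ : ℝ) : Prop :=
  ∀ (n : ℕ) (I : Instance n),
    Γ * (maxMatchingSize I.graph : ℝ) ≤ ∫ ω, (R.alg ω).size I ∂μ

/-- The function of the real parameter `k` whose maximum over `k ≥ 1` is `Γ*`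
(at `k = 1` the factor `0 ^ 0` is `1`). -/
noncomputable def ratioFun (k : ℝ) : ℝ :=
  1 / (((k + 1) / 2) ^ ((k + 1) / (2 * k)) * ((k - 1) / 2) ^ ((k - 1) / (2 * k)) + 1)

/-- The constant `Γ*`. -/
noncomputable def gammaStar : ℝ := sSup (ratioFun '' Set.Ici 1)

/-! The adversary is adaptive and recursive. Given a set `S` on one side, it presents a batch `V` of
vertices adjacent to all of `S`. Then it retires equally many vertices of `S` and of `V`, those with
the most free capacity, and the offline solution matches them with each other. The survivors on both
sides, on average at least as saturated as before, are treated recursively as two separate sets. At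
the end every remaining vertex gets a private leaf. With suitable batch sizes it does not help the
algorithm to match more inside a batch (`Achievable.step`), so its total gain is bounded as if it
had matched nothing there.

Sets are graded by levels `α 0 > ... > α n`, where `1 / (1 + α i)` is the value of a unit of free
capacity. Survivors of `S` move from level `i` to `i + 1`, and survivors of the batch start at level
`n - i` with smaller recursion depth. A `Γ`-competitive algorithm makes all `advantage`s
nonnegative. These obey a linear recursion in the depth, and weights `w` subinvariant under it turn
a negative weighted source term into unbounded decrease, a contradiction
(`not_isCompetitive_of_weights`).

As the mesh tends to zero, levels become a decreasing function of `u ∈ [-k, k]`, the exchange `i ↦ n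
- i` becomes `u ↦ -u`, and subinvariance with equality becomes a differential equation relating
`mass` at `u` and `-u`. The explicit pair `level`, `mass` solves it. For `coth k = k` both boundary
values `level k k` and `mass k (-k)` vanish, and the source term is negative exactly when `Γ > 1 /
(1 + exp 1 / (2 * sinh k))` (`HardInstance.not_isCompetitive`). A tangent-line bound shows that this
threshold is the maximum of `ratioFun` (`isGreatest_ratioFun`).

Randomization does not help: the expected decisions form a deterministic fractional algorithm with
the same expected size. -/

/-! ### Arrival sequences and their extensions by complete batches. -/

/-- An infinite arrival sequence, whose initial segments are inputs of the online problem. -/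
structure Arrivals where
  graph : SimpleGraph ℕ
  side : ℕ → Bool
  bipartite : ∀ ⦃u v : ℕ⦄, graph.Adj u v → side u ≠ side v

namespace Arrivals

/-- The input formed by the first `n` arrivals. -/
def initial (G : Arrivals) (n : ℕ) : Instance n where
  graph := G.graph.comap Fin.val
  side := fun u => G.side u
  bipartite := fun _ _ huv => G.bipartite huv

theorem firstArrivals_initial (G : Arrivals) {m n : ℕ} (h : m ≤ n) :
    (G.initial n).firstArrivals m h = G.initial m := rfl

theorem initial_eq_of_le {G G' : Arrivals} {m n : ℕ} (h : G'.initial n = G.initial n)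
    (hmn : m ≤ n) : G'.initial m = G.initial m := by
  rw [← firstArrivals_initial G hmn, ← firstArrivals_initial G' hmn, h]

theorem adj_iff_of_initial_eq {G G' : Arrivals} {n u v : ℕ} (h : G'.initial n = G.initial n)
    (hu : u < n) (hv : v < n) : G'.graph.Adj u v ↔ G.graph.Adj u v := by
  have := congrArg (fun I : Instance n => I.graph.Adj ⟨u, hu⟩ ⟨v, hv⟩) h
  exact iff_of_eq this

theorem side_eq_of_initial_eq {G G' : Arrivals} {n u : ℕ} (h : G'.initial n = G.initial n)
    (hu : u < n) : G'.side u = G.side u :=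
  congrArg (fun I : Instance n => I.side ⟨u, hu⟩) h

/-- The arrival sequence that follows `G` for the first `m` arrivals, and in which every later
vertex is adjacent to exactly the vertices of `S`, a set of old vertices on the side `b`. -/
def addBatch (G : Arrivals) (m : ℕ) (S : Finset ℕ) (b : Bool)
    (hS : ∀ u ∈ S, u < m ∧ G.side u = b) : Arrivals where
  graph :=
    { Adj := fun u v => (u < m ∧ v < m ∧ G.graph.Adj u v) ∨ (u ∈ S ∧ m ≤ v) ∨ (v ∈ S ∧ m ≤ u)
      symm := ⟨by
        rintro u v (⟨hu, hv, h⟩ | h | h)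
        · exact Or.inl ⟨hv, hu, h.symm⟩
        · exact Or.inr (Or.inr h)
        · exact Or.inr (Or.inl h)⟩
      loopless := ⟨by
        rintro u (⟨-, -, h⟩ | ⟨h, h'⟩ | ⟨h, h'⟩)
        · exact G.graph.loopless.irrefl u h
        · exact absurd (hS u h).1 (by omega)
        · exact absurd (hS u h).1 (by omega)⟩ }
  side := fun u => if u < m then G.side u else !b
  bipartite := by
    rintro u v (⟨hu, hv, h⟩ | ⟨h, h'⟩ | ⟨h, h'⟩)
    · simpa [hu, hv] using G.bipartite h
    · simp [(hS u h).1, (hS u h).2, Nat.not_lt.2 h']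
    · simp [(hS v h).1, (hS v h).2, Nat.not_lt.2 h']

section addBatch

variable {G : Arrivals} {m : ℕ} {S : Finset ℕ} {b : Bool}
  {hS : ∀ u ∈ S, u < m ∧ G.side u = b}

theorem initial_addBatch : (G.addBatch m S b hS).initial m = G.initial m := by
  have h1 : (G.addBatch m S b hS).graph.comap (Fin.val : Fin m → ℕ) =
      G.graph.comap (Fin.val : Fin m → ℕ) := by
    ext u v
    have hu := u.isLt
    have hv := v.isLt
    simp [addBatch, Nat.not_le.2 hu, Nat.not_le.2 hv]
  have h2 : (fun u : Fin m => (G.addBatch m S b hS).side u) = fun u : Fin m => G.side u := by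
    funext u
    simp [addBatch]
  unfold initial
  congr 1

theorem side_addBatch {v : ℕ} (hv : m ≤ v) : (G.addBatch m S b hS).side v = !b := by
  simp [addBatch, Nat.not_lt.2 hv]

theorem adj_addBatch {u v : ℕ} (hv : m ≤ v) :
    (G.addBatch m S b hS).graph.Adj u v ↔ u ∈ S := by
  have : v ∉ S := fun h => absurd (hS v h).1 (by omega)
  simp [addBatch, Nat.not_lt.2 hv, hv, this]

end addBatch

/-- `G'` with `m'` arrivals extends `G` with `m` arrivals, and the new edges that meet an old vertex
meet it in `S`. -/
structure IsExtension (G : Arrivals) (m : ℕ) (G' : Arrivals) (m' : ℕ) (S : Finset ℕ) : Prop where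
  le : m ≤ m'
  initial_eq : G'.initial m = G.initial m
  mem_of_adj : ∀ u v, u < m → m ≤ v → v < m' → G'.graph.Adj u v → u ∈ S

theorem IsExtension.trans {G G₁ G₂ : Arrivals} {m m₁ m₂ : ℕ} {S T : Finset ℕ}
    (h₁ : IsExtension G m G₁ m₁ S) (h₂ : IsExtension G₁ m₁ G₂ m₂ T)
    (hT : T ⊆ S ∪ Finset.Ico m m₁) : IsExtension G m G₂ m₂ S where
  le := h₁.le.trans h₂.le
  initial_eq := (initial_eq_of_le h₂.initial_eq h₁.le).trans h₁.initial_eq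
  mem_of_adj u v hu hv hv' huv := by
    have hle := h₁.le
    by_cases hvm : v < m₁
    · exact h₁.mem_of_adj u v hu hv hvm
        ((adj_iff_of_initial_eq h₂.initial_eq (by omega) hvm).1 huv)
    · have := hT (h₂.mem_of_adj u v (by omega) (by omega) hv' huv)
      simp only [Finset.mem_union, Finset.mem_Ico] at this
      exact this.resolve_right (by omega)

theorem IsExtension.mono {G G' : Arrivals} {m m' : ℕ} {S T : Finset ℕ}
    (h : IsExtension G m G' m' S) (hST : S ⊆ T) : IsExtension G m G' m' T :=
  ⟨h.le, h.initial_eq, fun u v hu hv hv' huv => hST (h.mem_of_adj u v hu hv hv' huv)⟩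

theorem isExtension_addBatch {G : Arrivals} {m : ℕ} {S : Finset ℕ} {b : Bool}
    {hS : ∀ u ∈ S, u < m ∧ G.side u = b} (M : ℕ) :
    IsExtension G m (G.addBatch m S b hS) (m + M) S :=
  ⟨by omega, initial_addBatch, fun _ _ _ hv _ huv => (adj_addBatch hv).1 huv⟩

end Arrivals

/-! ### Loads and gains along an arrival sequence. -/

namespace OnlineAlgorithm

open Arrivals

variable (A : OnlineAlgorithm)

/-- The value that the algorithm gives to a pair of vertices of an arrival sequence. -/
noncomputable def value (G : Arrivals) (u v : ℕ) : ℝ :=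
  if h : u < v then A.rule v (G.initial (v + 1)) ⟨u, h⟩
  else if h : v < u then A.rule u (G.initial (u + 1)) ⟨v, h⟩
  else 0

theorem value_eq_output (G : Arrivals) {n u v : ℕ} (hu : u < n) (hv : v < n) :
    A.value G u v = A.rule.output (G.initial n) ⟨u, hu⟩ ⟨v, hv⟩ := rfl

theorem value_comm (G : Arrivals) (u v : ℕ) : A.value G u v = A.value G v u := by
  have hu : u < max u v + 1 := by omega
  have hv : v < max u v + 1 := by omega
  rw [value_eq_output A G hu hv, value_eq_output A G hv hu]
  exact (A.feasible _ _).symm _ _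

theorem value_nonneg (G : Arrivals) (u v : ℕ) : 0 ≤ A.value G u v := by
  have hu : u < max u v + 1 := by omega
  have hv : v < max u v + 1 := by omega
  rw [value_eq_output A G hu hv]
  exact (A.feasible _ _).nonneg _ _

theorem value_eq_zero (G : Arrivals) {u v : ℕ} (h : ¬ G.graph.Adj u v) : A.value G u v = 0 := by
  have hu : u < max u v + 1 := by omega
  have hv : v < max u v + 1 := by omega
  rw [value_eq_output A G hu hv]
  exact (A.feasible _ _).eq_zero _ _ h

theorem value_congr {G G' : Arrivals} {n u v : ℕ} (h : G'.initial n = G.initial n)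
    (hu : u < n) (hv : v < n) : A.value G' u v = A.value G u v := by
  rw [value_eq_output A G hu hv, value_eq_output A G' hu hv, h]

/-- The matched portion of the vertex `u` after `m` arrivals. -/
noncomputable def load (G : Arrivals) (m u : ℕ) : ℝ := ∑ w ∈ Finset.range m, A.value G u w

theorem load_nonneg (G : Arrivals) (m u : ℕ) : 0 ≤ A.load G m u :=
  Finset.sum_nonneg fun _ _ => A.value_nonneg G _ _

theorem load_eq_sum_output (G : Arrivals) {m u : ℕ} (hu : u < m) :
    A.load G m u = ∑ w, A.rule.output (G.initial m) w ⟨u, hu⟩ := by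
  rw [load, Finset.sum_range]
  refine Finset.sum_congr rfl fun w _ => ?_
  rw [value_comm]
  exact value_eq_output A G w.isLt hu

theorem load_le_one (G : Arrivals) {m u : ℕ} (hu : u < m) : A.load G m u ≤ 1 := by
  rw [load_eq_sum_output A G hu]
  exact (A.feasible _ _).sum_le_one _

theorem load_congr {G G' : Arrivals} {n m u : ℕ} (h : G'.initial n = G.initial n)
    (hm : m ≤ n) (hu : u < n) : A.load G' m u = A.load G m u :=
  Finset.sum_congr rfl fun _ hw =>
    A.value_congr h hu ((Finset.mem_range.1 hw).trans_le hm)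

theorem load_add_sum_Ico (G : Arrivals) {m m' : ℕ} (h : m ≤ m') (u : ℕ) :
    A.load G m' u = A.load G m u + ∑ w ∈ Finset.Ico m m', A.value G u w :=
  (Finset.sum_range_add_sum_Ico _ h).symm

theorem load_eq_of_notMem {G G' : Arrivals} {m m' u : ℕ} {S : Finset ℕ}
    (h : IsExtension G m G' m' S) (hu : u < m) (huS : u ∉ S) :
    A.load G' m' u = A.load G m u := by
  rw [load_add_sum_Ico A G' h.le, load_congr A h.initial_eq le_rfl hu,
    Finset.sum_eq_zero, add_zero]
  intro w hw
  rw [Finset.mem_Ico] at hw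
  exact A.value_eq_zero _ fun hadj => huS (h.mem_of_adj u w hu hw.1 hw.2 hadj)

/-- The increase of the size of the matching due to the arrivals `m, …, m' - 1`. -/
noncomputable def gain (G : Arrivals) (m m' : ℕ) : ℝ := ∑ v ∈ Finset.Ico m m', A.load G v v

theorem gain_add (G : Arrivals) {m₁ m₂ m₃ : ℕ} (h : m₁ ≤ m₂) (h' : m₂ ≤ m₃) :
    A.gain G m₁ m₃ = A.gain G m₁ m₂ + A.gain G m₂ m₃ :=
  (Finset.sum_Ico_consecutive _ h h').symm

theorem gain_congr {G G' : Arrivals} {n m m' : ℕ} (h : G'.initial n = G.initial n)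
    (hm : m' ≤ n) : A.gain G' m m' = A.gain G m m' := by
  refine Finset.sum_congr rfl fun v hv => ?_
  rw [Finset.mem_Ico] at hv
  exact A.load_congr h (by omega) (by omega)

/-- Each edge is charged to its later endpoint, so the loads of all vertices add up to twice the
gain. -/
theorem size_initial (G : Arrivals) (m : ℕ) : A.size (G.initial m) = A.gain G 0 m := by
  have key : ∀ m : ℕ, ∑ v ∈ Finset.range m, A.load G m v = 2 * A.gain G 0 m := by
    intro m
    induction m with
    | zero => simp [gain]
    | succ m ih =>
      have h0 : A.value G m m = 0 := A.value_eq_zero G (G.graph.loopless.irrefl m)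
      have h1 : A.gain G 0 (m + 1) = A.gain G 0 m + A.load G m m := by
        rw [gain_add A G (Nat.zero_le m) (Nat.le_succ m)]
        simp [gain]
      have h2 : ∀ v, A.load G (m + 1) v = A.load G m v + A.value G v m := fun v =>
        Finset.sum_range_succ _ _
      have h3 : ∑ v ∈ Finset.range m, A.value G v m = A.load G m m :=
        Finset.sum_congr rfl fun v _ => A.value_comm G _ _
      rw [Finset.sum_range_succ, h1, h2 m, h0, add_zero]
      simp only [h2]
      rw [Finset.sum_add_distrib, ih, h3]
      ring
  have : ∑ v, ∑ u, A.rule.output (G.initial m) u v = ∑ v ∈ Finset.range m, A.load G m v := by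
    rw [Finset.sum_range]
    exact Finset.sum_congr rfl fun v _ => (A.load_eq_sum_output G v.isLt).symm
  rw [size, this, key]
  ring

section addBatch

variable {G : Arrivals} {m : ℕ} {S : Finset ℕ} {b : Bool}
  {hS : ∀ u ∈ S, u < m ∧ G.side u = b}

theorem load_addBatch_of_le {v n : ℕ} (hv : m ≤ v) (hn : m ≤ n) :
    A.load (G.addBatch m S b hS) n v = ∑ u ∈ S, A.value (G.addBatch m S b hS) v u := by
  refine (Finset.sum_subset ?_ ?_).symm
  · intro u hu
    exact Finset.mem_range.2 ((hS u hu).1.trans_le hn)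
  · intro u _ hu
    exact A.value_eq_zero _ fun h => hu ((adj_addBatch hv).1 h.symm)

/-- The new vertices have all their edges to `S`, so what they gain is exactly what `S` absorbs. -/
theorem sum_load_addBatch (M : ℕ) :
    ∑ u ∈ S, A.load (G.addBatch m S b hS) (m + M) u =
      ∑ u ∈ S, A.load G m u + A.gain (G.addBatch m S b hS) m (m + M) := by
  have h1 : ∀ u ∈ S, A.load (G.addBatch m S b hS) (m + M) u = A.load G m u +
      ∑ w ∈ Finset.Ico m (m + M), A.value (G.addBatch m S b hS) u w := fun u hu => by
    rw [load_add_sum_Ico A _ (Nat.le_add_right m M),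
      A.load_congr initial_addBatch le_rfl (hS u hu).1]
  rw [Finset.sum_congr rfl h1, Finset.sum_add_distrib, Finset.sum_comm, gain]
  congr 1
  refine Finset.sum_congr rfl fun v hv => ?_
  have hv := (Finset.mem_Ico.1 hv).1
  rw [A.load_addBatch_of_le hv hv]
  exact Finset.sum_congr rfl fun u _ => A.value_comm _ _ _

end addBatch

end OnlineAlgorithm

/-! ### Lower bounds on the offline matching. -/

/-- `HasMatching G T k`: the graph `G` has `k` disjoint edges with end points in `T`. -/
def HasMatching (G : SimpleGraph ℕ) (T : Finset ℕ) (k : ℕ) : Prop :=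
  ∃ (ι : Type) (_ : Fintype ι) (p q : ι → ℕ), Fintype.card ι = k ∧
    Function.Injective (Sum.elim p q) ∧ ∀ i, p i ∈ T ∧ q i ∈ T ∧ G.Adj (p i) (q i)

namespace HasMatching

theorem empty (G : SimpleGraph ℕ) (T : Finset ℕ) : HasMatching G T 0 :=
  ⟨Empty, inferInstance, Empty.elim, Empty.elim, rfl, Function.injective_of_subsingleton _,
    fun i => i.elim⟩

theorem of_forall {G G' : SimpleGraph ℕ} {T T' : Finset ℕ} {k : ℕ} (h : HasMatching G T k)
    (hT : T ⊆ T') (hG : ∀ u ∈ T, ∀ v ∈ T, G.Adj u v → G'.Adj u v) : HasMatching G' T' k := by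
  obtain ⟨ι, hι, p, q, hk, hinj, h⟩ := h
  exact ⟨ι, hι, p, q, hk, hinj, fun i =>
    ⟨hT (h i).1, hT (h i).2.1, hG _ (h i).1 _ (h i).2.1 (h i).2.2⟩⟩

theorem union {G : SimpleGraph ℕ} {T T' : Finset ℕ} {k k' : ℕ} (h : HasMatching G T k)
    (h' : HasMatching G T' k') (hd : Disjoint T T') : HasMatching G (T ∪ T') (k + k') := by
  obtain ⟨ι, hι, p, q, hk, hinj, h⟩ := h
  obtain ⟨ι', hι', p', q', hk', hinj', h'⟩ := h'
  refine ⟨ι ⊕ ι', inferInstance, Sum.elim p p', Sum.elim q q', by simp [hk, hk'], ?_, ?_⟩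
  · have hne : ∀ x y, Sum.elim p q x ≠ Sum.elim p' q' y := by
      intro x y hxy
      have hx : Sum.elim p q x ∈ T := by rcases x with i | i <;> simp [h i]
      have hy : Sum.elim p' q' y ∈ T' := by rcases y with i | i <;> simp [h' i]
      exact Finset.disjoint_left.1 hd hx (hxy ▸ hy)
    rintro ((i | i) | (i | i)) ((j | j) | (j | j)) hij <;> simp only [Sum.elim_inl, Sum.elim_inr] at hij
    · simpa using @hinj (.inl i) (.inl j) hij
    · exact absurd hij (hne (.inl i) (.inl j))
    · simpa using @hinj (.inl i) (.inr j) hij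
    · exact absurd hij (hne (.inl i) (.inr j))
    · exact absurd hij.symm (hne (.inl j) (.inl i))
    · simpa using @hinj' (.inl i) (.inl j) hij
    · exact absurd hij.symm (hne (.inr j) (.inl i))
    · simpa using @hinj' (.inl i) (.inr j) hij
    · simpa using @hinj (.inr i) (.inl j) hij
    · exact absurd hij (hne (.inr i) (.inl j))
    · simpa using @hinj (.inr i) (.inr j) hij
    · exact absurd hij (hne (.inr i) (.inr j))
    · exact absurd hij.symm (hne (.inl j) (.inr i))
    · simpa using @hinj' (.inr i) (.inl j) hij
    · exact absurd hij.symm (hne (.inr j) (.inr i))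
    · simpa using @hinj' (.inr i) (.inr j) hij
  · rintro (i | i)
    · simp [h i]
    · simp [h' i]

theorem of_complete {G : SimpleGraph ℕ} {S T : Finset ℕ} (hcard : S.card = T.card)
    (hd : Disjoint S T) (h : ∀ u ∈ S, ∀ v ∈ T, G.Adj u v) : HasMatching G (S ∪ T) S.card := by
  have e : S ≃ T := Finset.equivOfCardEq hcard
  refine ⟨S, inferInstance, fun u => u, fun u => e u, by simp, ?_, ?_⟩
  · rintro (i | i) (j | j) hij <;> simp only [Sum.elim_inl, Sum.elim_inr] at hij
    · rw [Subtype.ext hij]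
    · exact absurd hij (Finset.disjoint_iff_ne.1 hd _ i.2 _ (e j).2)
    · exact absurd hij.symm (Finset.disjoint_iff_ne.1 hd _ j.2 _ (e i).2)
    · rw [e.injective (Subtype.ext hij)]
  · intro i
    simp [h i i.2 (e i) (e i).2]

theorem le_maxMatchingSize {G : Arrivals} {T : Finset ℕ} {k m : ℕ} (h : HasMatching G.graph T k)
    (hT : ∀ u ∈ T, u < m) : k ≤ maxMatchingSize (G.initial m).graph := by
  obtain ⟨ι, hι, p, q, hk, hinj, h⟩ := h
  refine (isGreatest_maxMatchingSize _).2 ?_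
  let p' : ι → Fin m := fun i => ⟨p i, hT _ (h i).1⟩
  let q' : ι → Fin m := fun i => ⟨q i, hT _ (h i).2.1⟩
  have hadj : ∀ i, (G.initial m).graph.Adj (p' i) (q' i) := fun i => (h i).2.2
  have hpp : ∀ i j, p' i = p' j → i = j := fun i j hij => by
    simpa using @hinj (.inl i) (.inl j) (congrArg Fin.val hij)
  have hqq : ∀ i j, q' i = q' j → i = j := fun i j hij => by
    simpa using @hinj (.inr i) (.inr j) (congrArg Fin.val hij)
  have hpq : ∀ i j, p' i ≠ q' j := fun i j hij => by
    simpa using @hinj (.inl i) (.inr j) (congrArg Fin.val hij)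
  refine ⟨⨆ i, (G.initial m).graph.subgraphOfAdj (hadj i), ?_, ?_⟩
  · refine SimpleGraph.Subgraph.IsMatching.iSup
      (fun i => SimpleGraph.Subgraph.IsMatching.subgraphOfAdj (hadj i)) ?_
    intro i j hij
    simp only [SimpleGraph.support_subgraphOfAdj]
    rw [Set.disjoint_left]
    rintro x (rfl | rfl) (hx | hx)
    · exact hij (hpp _ _ hx)
    · exact hpq _ _ hx
    · exact hpq _ _ hx.symm
    · exact hij (hqq _ _ hx)
  · have : (⨆ i, (G.initial m).graph.subgraphOfAdj (hadj i)).edgeSet =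
        Set.range fun i => s(p' i, q' i) := by
      simp [SimpleGraph.Subgraph.edgeSet_iSup, Set.iUnion_singleton_eq_range]
    rw [this, Set.ncard_range_of_injective, Nat.card_eq_fintype_card, hk]
    intro i j hij
    rcases Sym2.eq_iff.1 hij with ⟨h1, -⟩ | ⟨h1, -⟩
    · exact hpp _ _ h1
    · exact absurd h1 (hpq _ _)

end HasMatching

/-! ### Averaging and integrality of batch sizes. -/

/-- Discarding a largest element never raises the average. With `r` the free capacity, this selects
the survivors. -/
theorem Finset.exists_subset_card_eq_sum_le {ι : Type*} [DecidableEq ι] (r : ι → ℝ)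
    (S : Finset ι) {t : ℕ} (ht : t ≤ S.card) :
    ∃ T ⊆ S, T.card = t ∧ ∑ u ∈ T, r u ≤ t / S.card * ∑ u ∈ S, r u := by
  induction S using Finset.strongInduction with
  | H S ih =>
    rcases ht.eq_or_lt with rfl | hlt
    · refine ⟨S, subset_rfl, rfl, ?_⟩
      rcases S.eq_empty_or_nonempty with rfl | hS
      · simp
      · rw [div_self (by exact_mod_cast hS.card_pos.ne'), one_mul]
    · rcases Nat.eq_zero_or_pos t with rfl | htpos
      · exact ⟨∅, by simp, rfl, by simp⟩
      · have hS : S.Nonempty := Finset.card_pos.1 (by omega)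
        obtain ⟨u, hu, hmax⟩ := S.exists_max_image r hS
        have hc : (S.erase u).card = S.card - 1 := Finset.card_erase_of_mem hu
        obtain ⟨T, hTS, hT, hsum⟩ := ih (S.erase u) (Finset.erase_ssubset hu) (by omega)
        refine ⟨T, hTS.trans (Finset.erase_subset _ _), hT, hsum.trans ?_⟩
        have h1 : ∑ v ∈ S, r v = ∑ v ∈ S.erase u, r v + r u := (Finset.sum_erase_add _ _ hu).symm
        have h2 : ∑ v ∈ S.erase u, r v ≤ (S.erase u).card * r u := by
          rw [← nsmul_eq_mul]
          exact Finset.sum_le_card_nsmul _ _ _ fun v hv => hmax v (Finset.mem_of_mem_erase hv)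
        have h3 : ((S.erase u).card : ℝ) + 1 = S.card := by
          rw [hc]
          exact_mod_cast Nat.sub_add_cancel hS.card_pos
        have h4 : (0 : ℝ) < (S.erase u).card := by
          rw [hc]
          exact_mod_cast (by omega : 0 < S.card - 1)
        rw [h1, ← h3, div_mul_eq_mul_div, div_mul_eq_mul_div, div_le_div_iff₀ h4 (by linarith)]
        have h5 : (0 : ℝ) ≤ t := Nat.cast_nonneg t
        nlinarith [mul_le_mul_of_nonneg_left h2 h5]

/-- Makes a rational fraction of `S` an actual number of vertices, still divisible by the moduli
that the recursive calls require. -/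
theorem Rat.exists_nat_eq_mul {δ : ℚ} (hδ : 0 ≤ δ) {q c N : ℕ} (h : q * δ.den * c ∣ N) :
    ∃ d : ℕ, (d : ℝ) = δ * N ∧ q ∣ d := by
  obtain ⟨t, rfl⟩ := h
  refine ⟨q * c * t * δ.num.toNat, ?_, ⟨c * t * δ.num.toNat, by ring⟩⟩
  have h1 : ((δ.num.toNat : ℕ) : ℝ) = δ * δ.den := by
    have h2 : ((δ.num.toNat : ℕ) : ℤ) = δ.num := Int.toNat_of_nonneg (Rat.num_nonneg.2 hδ)
    have h3 : (δ : ℝ) * δ.den = δ.num := by exact_mod_cast Rat.mul_den_eq_num δ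
    rw [h3]
    exact_mod_cast h2
  push_cast
  rw [h1]
  ring

/-! ### One round of the adversary. -/

namespace OnlineAlgorithm

open Arrivals

variable (A : OnlineAlgorithm)

/-- Against `A` and from any current position, the adversary can extend a set `S` of vertices on
one side (with `S.card` divisible by a fixed number) by a subinstance that has a matching of size
at least `W` per vertex of `S`, but in which `A` gains at most `a` times the remaining capacity
of `S`, plus `P - a` per vertex of `S`. -/
def Achievable (a P W : ℝ) : Prop :=
  ∃ Q : ℕ, 0 < Q ∧ ∀ (G : Arrivals) (m : ℕ) (S : Finset ℕ) (b : Bool),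
    (∀ u ∈ S, u < m ∧ G.side u = b) → Q ∣ S.card →
    ∃ (G' : Arrivals) (m' k : ℕ), IsExtension G m G' m' S ∧
      A.gain G' m m' ≤ a * ∑ u ∈ S, (1 - A.load G m u) + (P - a) * S.card ∧
      HasMatching G'.graph (S ∪ Finset.Ico m m') k ∧ W * S.card ≤ k

variable {A}

/-- A private leaf can only use the free capacity of its neighbour, while offline it matches that
neighbour completely. This ends every branch of the recursion. -/
theorem exists_extension_by_leaves (G : Arrivals) (m : ℕ) (S : Finset ℕ) (hS : ∀ u ∈ S, u < m) :
    ∃ (G' : Arrivals) (m' : ℕ), IsExtension G m G' m' S ∧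
      A.gain G' m m' ≤ ∑ u ∈ S, (1 - A.load G m u) ∧
      HasMatching G'.graph (S ∪ Finset.Ico m m') S.card := by
  induction S using Finset.induction_on with
  | empty =>
    exact ⟨G, m, ⟨le_rfl, rfl, fun u v _ hv hv' => absurd hv' (by omega)⟩, by simp [gain],
      HasMatching.empty _ _⟩
  | insert u T huT ih =>
    obtain ⟨G₁, m₁, hext, hgain, hmatch⟩ := ih fun v hv => hS v (Finset.mem_insert_of_mem hv)
    have hum : u < m := hS u (Finset.mem_insert_self _ _)
    have hle := hext.le
    have hu₁ : ∀ v ∈ ({u} : Finset ℕ), v < m₁ ∧ G₁.side v = G₁.side u := by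
      simp only [Finset.mem_singleton, forall_eq, and_true]
      omega
    have hext₂ := isExtension_addBatch (hS := hu₁) 1
    refine ⟨G₁.addBatch m₁ {u} (G₁.side u) hu₁, m₁ + 1, ?_, ?_, ?_⟩
    · exact (hext.mono (Finset.subset_insert u T)).trans hext₂ (by simp)
    · have h1 := A.sum_load_addBatch (hS := hu₁) 1
      simp only [Finset.sum_singleton] at h1
      have h2 : A.load (G₁.addBatch m₁ {u} (G₁.side u) hu₁) (m₁ + 1) u ≤ 1 :=
        A.load_le_one _ (by omega)
      have h3 : A.load G₁ m₁ u = A.load G m u := A.load_eq_of_notMem hext hum huT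
      rw [gain_add A _ hle (Nat.le_succ m₁), Finset.sum_insert huT,
        A.gain_congr hext₂.initial_eq le_rfl]
      linarith
    · rw [Finset.card_insert_of_notMem huT]
      have h1 : HasMatching (G₁.addBatch m₁ {u} (G₁.side u) hu₁).graph
          (T ∪ Finset.Ico m m₁) T.card := by
        refine hmatch.of_forall subset_rfl fun x hx y hy hxy => ?_
        have hlt : ∀ z ∈ T ∪ Finset.Ico m m₁, z < m₁ := by
          intro z hz
          rcases Finset.mem_union.1 hz with hz | hz
          · exact (hS z (Finset.mem_insert_of_mem hz)).trans_le hle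
          · exact (Finset.mem_Ico.1 hz).2
        exact (adj_iff_of_initial_eq hext₂.initial_eq (hlt x hx) (hlt y hy)).2 hxy
      have h2 : HasMatching (G₁.addBatch m₁ {u} (G₁.side u) hu₁).graph ({u} ∪ {m₁})
          ({u} : Finset ℕ).card := by
        refine HasMatching.of_complete (by simp) (by simp; omega) ?_
        intro x hx y hy
        rw [Finset.mem_singleton.1 hy]
        exact (adj_addBatch le_rfl).2 hx
      refine (h1.union h2 ?_).of_forall ?_ fun _ _ _ _ h => h
      · rw [Finset.disjoint_left]
        intro x hx
        have := fun h => hS x (Finset.mem_insert_of_mem h)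
        simp only [Finset.mem_union, Finset.mem_Ico, Finset.mem_singleton] at hx ⊢
        rintro (rfl | rfl)
        · exact huT (hx.resolve_right (by omega))
        · exact absurd (hx.imp_left this) (by omega)
      · intro x hx
        simp only [Finset.mem_union, Finset.mem_Ico, Finset.mem_singleton, Finset.mem_insert]
          at hx ⊢
        rcases hx with (hx | hx) | (hx | hx)
        · exact Or.inl (Or.inr hx)
        · exact Or.inr (by omega)
        · exact Or.inl (Or.inl hx)
        · exact Or.inr (by omega)

/-- The free capacity of `S` is at most `S.card`, so lowering the coefficient `a` below `1` and
adding `1 - a` per vertex only weakens the bound given by the leaves. -/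
theorem achievable_one {a : ℝ} (ha : a ≤ 1) : A.Achievable a 1 1 := by
  refine ⟨1, one_pos, fun G m S b hS _ => ?_⟩
  obtain ⟨G', m', hext, hgain, hmatch⟩ :=
    exists_extension_by_leaves (A := A) G m S fun u hu => (hS u hu).1
  refine ⟨G', m', S.card, hext, hgain.trans ?_, hmatch, by simp⟩
  have : ∑ u ∈ S, (1 - A.load G m u) ≤ S.card := by
    rw [Finset.sum_sub_distrib]
    simpa using Finset.sum_nonneg fun u _ => A.load_nonneg G m u
  nlinarith

/-- A batch of `μ * S.card` vertices is joined to `S`, and `δ * S.card` vertices on each side are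
retired and matched to each other offline. By averaging, the survivors of `S` and of the batch keep
at most the fractions `1 - δ` and `(μ - δ) / μ` of the free capacity. A unit matched in the batch
gains `1` but costs `a' * (1 - δ) + b * (μ - δ) / μ` later; `hcond` says that the cost is at least
the gain. -/
theorem Achievable.step {a' P' W' b P'' W'' : ℝ} {δ μ : ℚ} (h' : A.Achievable a' P' W')
    (h'' : A.Achievable b P'' W'') (ha' : 0 ≤ a') (hb : 0 ≤ b) (hδ : 0 ≤ δ) (hδ1 : δ ≤ 1)
    (hδμ : δ ≤ μ) (hμ : 0 < μ) (hcond : (μ : ℝ) ≤ a' * (1 - δ) * μ + b * (μ - δ)) :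
    A.Achievable (a' * (1 - δ)) ((1 - δ) * P' + (μ - δ) * P'')
      ((1 - δ) * W' + (μ - δ) * W'' + δ) := by
  obtain ⟨Q', hQ', h'⟩ := h'
  obtain ⟨Q'', hQ'', h''⟩ := h''
  refine ⟨Q' * Q'' * δ.den * μ.den,
    Nat.mul_pos (Nat.mul_pos (Nat.mul_pos hQ' hQ'') δ.pos) μ.pos, fun G m S s hS hdvd => ?_⟩
  have hδ1R : (δ : ℝ) ≤ 1 := by exact_mod_cast hδ1
  have hδμR : (δ : ℝ) ≤ μ := by exact_mod_cast hδμ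
  have hμR : (0 : ℝ) < μ := by exact_mod_cast hμ
  obtain ⟨d, hd, hdQ⟩ := Rat.exists_nat_eq_mul hδ hdvd
  obtain ⟨M, hM, hMQ⟩ := Rat.exists_nat_eq_mul hμ.le (q := Q' * Q'') (c := δ.den) (N := S.card)
    (by convert hdvd using 1; ring)
  have hSQ : Q' * Q'' ∣ S.card := (Dvd.intro (δ.den * μ.den) (by ring)).trans hdvd
  have hdN : d ≤ S.card := by
    have : (d : ℝ) ≤ S.card := by
      rw [hd]
      nlinarith [(Nat.cast_nonneg S.card : (0 : ℝ) ≤ S.card)]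
    exact_mod_cast this
  have hdM : d ≤ M := by
    have : (d : ℝ) ≤ M := by
      rw [hd, hM]
      exact mul_le_mul_of_nonneg_right hδμR (Nat.cast_nonneg _)
    exact_mod_cast this
  rcases S.eq_empty_or_nonempty with rfl | hSne
  · exact ⟨G, m, 0, ⟨le_rfl, rfl, fun u v _ hv hv' => absurd hv' (by omega)⟩, by simp [gain],
      HasMatching.empty _ _, by simp⟩
  have hN : (0 : ℝ) < S.card := by exact_mod_cast hSne.card_pos
  -- the batch of `M` vertices adjacent to all of `S`
  set G₁ := G.addBatch m S s hS with hG₁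
  have hext₁ : IsExtension G m G₁ (m + M) S := isExtension_addBatch M
  set V := Finset.Ico m (m + M) with hV
  have hVcard : V.card = M := by simp [hV]
  set Y := A.gain G₁ m (m + M) with hY
  have hY0 : 0 ≤ Y := Finset.sum_nonneg fun _ _ => A.load_nonneg _ _ _
  obtain ⟨S', hS'S, hS'card, hS'sum⟩ := Finset.exists_subset_card_eq_sum_le
    (fun u => 1 - A.load G₁ (m + M) u) S (Nat.sub_le S.card d)
  obtain ⟨V', hV'V, hV'card, hV'sum⟩ := Finset.exists_subset_card_eq_sum_le
    (fun v => 1 - A.load G₁ (m + M) v) V (t := M - d) (by omega)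
  have hSlt : ∀ u ∈ S, u < m := fun u hu => (hS u hu).1
  have hVlt : ∀ v ∈ V, m ≤ v ∧ v < m + M := fun v hv => Finset.mem_Ico.1 hv
  have hsumS : ∑ u ∈ S, (1 - A.load G₁ (m + M) u) = ∑ u ∈ S, (1 - A.load G m u) - Y := by
    rw [Finset.sum_sub_distrib, Finset.sum_sub_distrib, hG₁, A.sum_load_addBatch M]
    ring
  have hsumV : ∑ v ∈ V, (1 - A.load G₁ (m + M) v) = M - Y := by
    rw [Finset.sum_sub_distrib, Finset.sum_const, hVcard, hY, gain]
    simp only [nsmul_eq_mul, mul_one]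
    congr 1
    refine Finset.sum_congr rfl fun v hv => ?_
    rw [A.load_addBatch_of_le (hVlt v hv).1 (by omega), A.load_addBatch_of_le (hVlt v hv).1
      (hVlt v hv).1]
  have hS'cast : ((S.card - d : ℕ) : ℝ) = (1 - δ) * S.card := by
    rw [Nat.cast_sub hdN, hd]
    ring
  have hV'cast : ((M - d : ℕ) : ℝ) = (μ - δ) * S.card := by
    rw [Nat.cast_sub hdM, hd, hM]
    ring
  rw [hsumS, hS'cast, mul_div_assoc, div_self hN.ne', mul_one] at hS'sum
  rw [hsumV, hV'cast, hVcard, hM, mul_div_mul_right _ _ hN.ne'] at hV'sum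
  -- the subinstance on the survivors of `S`
  have hS'side : ∀ u ∈ S', u < m + M ∧ G₁.side u = s := fun u hu =>
    ⟨(hSlt u (hS'S hu)).trans_le (Nat.le_add_right _ _),
      (side_eq_of_initial_eq hext₁.initial_eq (hSlt u (hS'S hu))).trans (hS u (hS'S hu)).2⟩
  obtain ⟨G₂, m₂, k₂, hext₂, hgain₂, hmatch₂, hk₂⟩ := h' G₁ (m + M) S' s hS'side (by
    rw [hS'card]
    exact Nat.dvd_sub ((Dvd.intro _ rfl).trans hSQ) ((Dvd.intro _ rfl).trans hdQ))
  have hle₂ := hext₂.le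
  -- the subinstance on the survivors of the batch
  have hV'side : ∀ v ∈ V', v < m₂ ∧ G₂.side v = !s := fun v hv =>
    ⟨(hVlt v (hV'V hv)).2.trans_le hle₂,
      (side_eq_of_initial_eq hext₂.initial_eq (hVlt v (hV'V hv)).2).trans
        (side_addBatch (hVlt v (hV'V hv)).1)⟩
  obtain ⟨G₃, m₃, k₃, hext₃, hgain₃, hmatch₃, hk₃⟩ := h'' G₂ m₂ V' (!s) hV'side (by
    rw [hV'card]
    exact Nat.dvd_sub ((Dvd.intro_left _ rfl).trans hMQ) ((Dvd.intro_left _ rfl).trans hdQ))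
  have hle₃ := hext₃.le
  have hSV : ∀ u ∈ S, u ∉ V := fun u hu huV => absurd (hSlt u hu) (by have := hVlt u huV; omega)
  -- The subinstance on `S'` does not touch the batch, so playing it first leaves the capacities in
  -- `V'` unchanged.
  have hloadV : ∑ v ∈ V', (1 - A.load G₂ m₂ v) = ∑ v ∈ V', (1 - A.load G₁ (m + M) v) :=
    Finset.sum_congr rfl fun v hv => by
      rw [A.load_eq_of_notMem hext₂ (hVlt v (hV'V hv)).2 fun h => hSV v (hS'S h) (hV'V hv)]
  refine ⟨G₃, m₃, d + k₂ + k₃, ?_, ?_, ?_, ?_⟩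
  · refine (hext₁.trans hext₂ (hS'S.trans Finset.subset_union_left)).trans hext₃ fun v hv => ?_
    have := hVlt v (hV'V hv)
    exact Finset.mem_union_right _ (Finset.mem_Ico.2 (by omega))
  · have hg : A.gain G₃ m m₃ =
        Y + A.gain G₂ (m + M) m₂ + A.gain G₃ m₂ m₃ := by
      rw [gain_add A G₃ (Nat.le_add_right m M) (hle₂.trans hle₃), gain_add A G₃ hle₂ hle₃,
        A.gain_congr hext₃.initial_eq le_rfl, A.gain_congr hext₃.initial_eq hle₂,
        A.gain_congr hext₂.initial_eq le_rfl]
      ring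
    rw [hg]
    rw [hloadV, hV'card, hV'cast] at hgain₃
    rw [hS'card, hS'cast] at hgain₂
    have e1 := mul_le_mul_of_nonneg_left hS'sum ha'
    have e2 := mul_le_mul_of_nonneg_left hV'sum hb
    -- The net effect of `Y` on the bound is nonpositive, so `Y = 0` is the worst case.
    have e3 : 0 ≤ Y * (a' * (1 - δ) + b * ((μ - δ) / μ) - 1) := by
      refine mul_nonneg hY0 ?_
      have : (μ : ℝ) * (a' * (1 - δ) + b * ((μ - δ) / μ) - 1) =
        a' * (1 - δ) * μ + b * (μ - δ) - μ := by
        field_simp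
      nlinarith [nonneg_of_mul_nonneg_right (by rw [this]; linarith :
        0 ≤ (μ : ℝ) * (a' * (1 - δ) + b * ((μ - δ) / μ) - 1)) hμR]
    have e4 : b * ((μ - δ) / μ * (μ * S.card - Y)) =
        b * (μ - δ) * S.card - b * ((μ - δ) / μ) * Y := by
      field_simp
    rw [e4] at e2
    linarith
  · have hadj₁ : ∀ u ∈ S \ S', ∀ v ∈ V \ V', G₃.graph.Adj u v := by
      intro u hu v hv
      have hu := (Finset.mem_sdiff.1 hu).1
      have hv := (Finset.mem_sdiff.1 hv).1
      have h1 := hSlt u hu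
      have h2 := hVlt v hv
      exact (adj_iff_of_initial_eq hext₃.initial_eq (by omega) (by omega)).2
        ((adj_iff_of_initial_eq hext₂.initial_eq (by omega) (by omega)).2
          ((adj_addBatch h2.1).2 hu))
    have hc1 : (S \ S').card = d := by
      rw [Finset.card_sdiff_of_subset hS'S]
      omega
    have hc2 : (V \ V').card = d := by
      rw [Finset.card_sdiff_of_subset hV'V]
      omega
    have hm1 := HasMatching.of_complete (hc1.trans hc2.symm) (Finset.disjoint_left.2 fun u hu hu' =>
      hSV u (Finset.mem_sdiff.1 hu).1 (Finset.mem_sdiff.1 hu').1) hadj₁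
    rw [hc1] at hm1
    have hm2 : HasMatching G₃.graph (S' ∪ Finset.Ico (m + M) m₂) k₂ := by
      refine hmatch₂.of_forall subset_rfl fun x hx y hy hxy => ?_
      have hlt : ∀ z ∈ S' ∪ Finset.Ico (m + M) m₂, z < m₂ := by
        intro z hz
        rcases Finset.mem_union.1 hz with hz | hz
        · exact (hS'side z hz).1.trans_le hle₂
        · exact (Finset.mem_Ico.1 hz).2
      exact (adj_iff_of_initial_eq hext₃.initial_eq (hlt x hx) (hlt y hy)).2 hxy
    refine ((hm1.union hm2 ?_).union hmatch₃ ?_).of_forall ?_ fun _ _ _ _ h => h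
    · rw [Finset.disjoint_left]
      intro x hx hx'
      simp only [Finset.mem_union, Finset.mem_sdiff, Finset.mem_Ico] at hx hx'
      rcases hx with ⟨hx, hxS⟩ | ⟨hx, hxV⟩
      · have := hSlt x hx
        exact hx'.elim hxS (by omega)
      · have := hVlt x hx
        exact hx'.elim (fun h => hSV x (hS'S h) hx) (by omega)
    · rw [Finset.disjoint_left]
      intro x hx hx'
      simp only [Finset.mem_union, Finset.mem_sdiff, Finset.mem_Ico] at hx hx'
      rcases hx' with hx' | hx'
      · have := hVlt x (hV'V hx')
        rcases hx with (⟨hx, -⟩ | ⟨-, hx⟩) | (hx | hx)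
        · exact hSV x hx (hV'V hx')
        · exact hx hx'
        · exact hSV x (hS'S hx) (hV'V hx')
        · omega
      · rcases hx with (⟨hx, -⟩ | ⟨hx, -⟩) | (hx | hx)
        · have := hSlt x hx
          omega
        · have := hVlt x hx
          omega
        · have := hSlt x (hS'S hx)
          omega
        · omega
    · intro x hx
      simp only [Finset.mem_union, Finset.mem_sdiff, Finset.mem_Ico] at hx ⊢
      rcases hx with ((⟨hx, -⟩ | ⟨hx, -⟩) | (hx | hx)) | (hx | hx)
      · exact Or.inl hx
      · have := hVlt x hx
        exact Or.inr (by omega)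
      · exact Or.inl (hS'S hx)
      · exact Or.inr (by omega)
      · have := hVlt x (hV'V hx)
        exact Or.inr (by omega)
      · exact Or.inr (by omega)
  · push_cast
    rw [hS'card, hS'cast] at hk₂
    rw [hV'card, hV'cast] at hk₃
    rw [hd]
    linarith

/-- Starting from isolated, hence unloaded, vertices the gain is at most `a + (P - a) = P` per
vertex. -/
theorem Achievable.le_of_isCompetitive {a P W Γ : ℝ} (h : A.Achievable a P W)
    (hΓ : 0 ≤ Γ) (hA : A.IsCompetitive Γ) : Γ * W ≤ P := by
  obtain ⟨Q, hQ, h⟩ := h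
  let G : Arrivals := ⟨⊥, fun _ => true, fun _ _ h => absurd h (by simp)⟩
  obtain ⟨G', m', k, hext, hgain, hmatch, hk⟩ := h G Q (Finset.range Q) true
    (fun u hu => ⟨Finset.mem_range.1 hu, rfl⟩) (by simp)
  have hval : ∀ m u, A.load G m u = 0 := fun m u =>
    Finset.sum_eq_zero fun w _ => A.value_eq_zero G (by simp [G])
  have h0 : A.gain G' 0 Q = 0 := by
    rw [A.gain_congr hext.initial_eq le_rfl]
    exact Finset.sum_eq_zero fun v _ => hval v v
  have hsize := hA m' (G'.initial m')
  have hle := hext.le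
  have hmax : (k : ℝ) ≤ maxMatchingSize (G'.initial m').graph := by
    exact_mod_cast hmatch.le_maxMatchingSize (m := m') (by
      intro u hu
      simp only [Finset.mem_union, Finset.mem_range, Finset.mem_Ico] at hu
      omega)
  rw [A.size_initial, A.gain_add G' (Nat.zero_le Q) hle, h0] at hsize
  simp only [hval, Finset.card_range, sub_zero, Finset.sum_const, nsmul_eq_mul, mul_one]
    at hgain hk
  have hQ' : (0 : ℝ) < Q := by exact_mod_cast hQ
  have : Γ * W * Q ≤ P * Q := by
    have := mul_le_mul_of_nonneg_left (hk.trans hmax) hΓ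
    linarith
  exact le_of_mul_le_mul_right this hQ'

end OnlineAlgorithm

/-! ### Levels, recursion depth and subinvariant weights. -/

namespace OnlineAlgorithm

/-- The weight with which the subinstances started on the survivors of the `j`-th batch enter. -/
noncomputable def batchWeight (α : ℕ → ℝ) (n j : ℕ) : ℝ :=
  (α j - α (j + 1)) * α j / (1 - α j * α (n - j))

/-- The normalized difference of the costs `P` and `Γ * W` of the adversary of recursion depth `D`
that starts at level `i`. -/
noncomputable def advantage (Γ : ℝ) (α : ℕ → ℝ) (n : ℕ) : ℕ → ℕ → ℝ
  | 0, i => (1 - Γ) * (1 + α i)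
  | D + 1, i => 1 - Γ - Γ * α i + α n +
      ∑ j ∈ Finset.Ico i n, batchWeight α n j * advantage Γ α n D (n - j)

variable {A : OnlineAlgorithm}

/-- The choice `δ = (α i - α (i + 1)) / (1 + α i)` turns the coefficient `1 / (1 + α (i + 1))` into
`1 / (1 + α i)`, and `μ = (α i - α (i + 1)) / (1 - α i * α (n - i))` gives equality in the condition
of `Achievable.step`. Depth drops only for the batch, so the induction on depth contains a downward
induction on the level. -/
theorem exists_achievable_advantage (Γ : ℝ) {α : ℕ → ℚ} {n : ℕ} (hpos : ∀ i ≤ n, 0 < α i)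
    (hanti : ∀ i < n, α (i + 1) < α i) (hlt : ∀ j < n, α j * α (n - j) < 1)
    (D i : ℕ) (hi : i ≤ n) :
    ∃ P W : ℝ, A.Achievable (1 / (1 + α i)) P W ∧
      P - Γ * W = 1 / (1 + α i) * advantage Γ (fun i => α i) n D i := by
  have hposR : ∀ i ≤ n, (0 : ℝ) < α i := fun i hi => by exact_mod_cast hpos i hi
  have hone : ∀ i ≤ n, (1 : ℝ) / (1 + α i) ≤ 1 := fun i hi => by
    have := hposR i hi
    rw [div_le_one (by linarith)]
    linarith
  induction D generalizing i with
  | zero =>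
    refine ⟨1, 1, achievable_one (hone i hi), ?_⟩
    have := hposR i hi
    rw [advantage]
    field_simp
  | succ D ihD =>
    induction hi using Nat.decreasingInduction with
    | self =>
      refine ⟨1, 1, achievable_one (hone n le_rfl), ?_⟩
      have := hposR n le_rfl
      simp only [advantage, Finset.Ico_self, Finset.sum_empty]
      field_simp
      ring
    | of_succ i hi ih =>
      obtain ⟨P', W', h', e'⟩ := ih
      obtain ⟨P'', W'', h'', e''⟩ := ihD (n - i) (Nat.sub_le n i)
      have p1 := hpos i hi.le
      have p2 := hpos (i + 1) hi
      have p3 := hpos (n - i) (Nat.sub_le n i)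
      have l1 := hanti i hi
      have l2 := hlt i hi
      have hδ : 0 ≤ (α i - α (i + 1)) / (1 + α i) := div_nonneg (by linarith) (by linarith)
      have hδ1 : (α i - α (i + 1)) / (1 + α i) ≤ 1 := by
        rw [div_le_one (by linarith)]
        linarith
      have hδμ : (α i - α (i + 1)) / (1 + α i) ≤ (α i - α (i + 1)) / (1 - α i * α (n - i)) := by
        refine div_le_div_of_nonneg_left (by linarith) (by linarith) ?_
        nlinarith [mul_pos p1 p3]
      have hμ : 0 < (α i - α (i + 1)) / (1 - α i * α (n - i)) :=
        div_pos (by linarith) (by linarith)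
      have q1 : (0 : ℝ) < α i := hposR i hi.le
      have q2 : (0 : ℝ) < α (i + 1) := hposR (i + 1) hi
      have q3 : (0 : ℝ) < α (n - i) := hposR (n - i) (Nat.sub_le n i)
      have r1 : (1 + α i : ℝ) ≠ 0 := by linarith
      have r2 : (1 + α (i + 1) : ℝ) ≠ 0 := by linarith
      have r3 : (1 + α (n - i) : ℝ) ≠ 0 := by linarith
      have q4 : (α i * α (n - i) : ℝ) < 1 := by exact_mod_cast l2
      have r4 : (1 - α i * α (n - i) : ℝ) ≠ 0 := by linarith
      have hstep := h'.step h'' (by positivity) (by positivity) hδ hδ1 hδμ hμ (by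
        push_cast
        refine le_of_eq ?_
        field_simp
        ring)
      push_cast at hstep
      have ha : 1 / (1 + α (i + 1) : ℝ) * (1 - (α i - α (i + 1)) / (1 + α i)) =
          1 / (1 + α i) := by
        field_simp
        ring
      rw [ha] at hstep
      refine ⟨_, _, hstep, ?_⟩
      have eP' : P' = Γ * W' +
          1 / (1 + α (i + 1)) * advantage Γ (fun i => (α i : ℝ)) n (D + 1) (i + 1) := by
        linarith
      have eP'' : P'' = Γ * W'' +
          1 / (1 + α (n - i)) * advantage Γ (fun i => (α i : ℝ)) n D (n - i) := by
        linarith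
      rw [eP', eP'', advantage, advantage, Finset.sum_eq_sum_Ico_succ_bot hi, batchWeight]
      generalize advantage Γ (fun i => (α i : ℝ)) n D (n - i) = z
      generalize ∑ j ∈ Finset.Ico (i + 1) n, batchWeight (fun i => (α i : ℝ)) n j *
        advantage Γ (fun i => (α i : ℝ)) n D (n - j) = s
      field_simp
      ring

/-- No algorithm is `Γ`-competitive if there are levels `α` and weights `w` such that the weighted
sum of the advantages of the adversaries decreases with the recursion depth. -/
theorem not_isCompetitive_of_weights {Γ : ℝ} (hΓ : 0 ≤ Γ) {α : ℕ → ℚ} {n : ℕ}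
    (hpos : ∀ i ≤ n, 0 < α i) (hanti : ∀ i < n, α (i + 1) < α i)
    (hlt : ∀ j < n, α j * α (n - j) < 1) {w : ℕ → ℝ} (hw : ∀ i ≤ n, 0 ≤ w i)
    (hbatch : ∀ j < n, (α j - α (j + 1)) * α j * ∑ i ∈ Finset.range (j + 1), w i ≤
      w (n - j) * (1 - α j * α (n - j)))
    (hneg : ∑ i ∈ Finset.range (n + 1), w i * (1 - Γ - Γ * α i + α n) < 0) :
    ¬ A.IsCompetitive Γ := by
  intro hA
  set z := advantage Γ (fun i => (α i : ℝ)) n with hz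
  have hz0 : ∀ D, ∀ i ≤ n, 0 ≤ z D i := by
    intro D i hi
    obtain ⟨P, W, h, e⟩ := exists_achievable_advantage (A := A) Γ hpos hanti hlt D i hi
    have h1 := h.le_of_isCompetitive hΓ hA
    have h2 : (0 : ℝ) < α i := by exact_mod_cast hpos i hi
    refine nonneg_of_mul_nonneg_right (a := 1 / (1 + α i : ℝ)) ?_ (by positivity)
    rw [hz, ← e]
    linarith
  set c := ∑ i ∈ Finset.range (n + 1), w i * (1 - Γ - Γ * α i + α n) with hc
  have hdec : ∀ D, ∑ i ∈ Finset.range (n + 1), w i * z (D + 1) i ≤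
      c + ∑ i ∈ Finset.range (n + 1), w i * z D i := by
    intro D
    have h1 : ∑ i ∈ Finset.range (n + 1), w i * z (D + 1) i = c +
        ∑ i ∈ Finset.range (n + 1), ∑ j ∈ Finset.Ico i n,
          w i * (batchWeight (fun i => (α i : ℝ)) n j * z D (n - j)) := by
      rw [hc, ← Finset.sum_add_distrib]
      refine Finset.sum_congr rfl fun i _ => ?_
      rw [hz, advantage, mul_add, Finset.mul_sum]
    have h2 : ∑ i ∈ Finset.range (n + 1), ∑ j ∈ Finset.Ico i n,
        w i * (batchWeight (fun i => (α i : ℝ)) n j * z D (n - j)) =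
        ∑ j ∈ Finset.range n, (∑ i ∈ Finset.range (j + 1), w i) *
          (batchWeight (fun i => (α i : ℝ)) n j * z D (n - j)) := by
      simp only [Finset.sum_mul]
      refine Finset.sum_comm' fun i j => ?_
      simp only [Finset.mem_range, Finset.mem_Ico]
      omega
    have h3 : ∑ i ∈ Finset.range (n + 1), w i * z D i =
        -- Only the indices `n - j ≥ 1` occur as batch restarts; the leftover term at index `0` is
        -- nonnegative and is dropped.
        ∑ j ∈ Finset.range n, w (n - j) * z D (n - j) + w 0 * z D 0 := by
      rw [Finset.sum_range_succ', ← Finset.sum_range_reflect]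
      congr 1
      refine Finset.sum_congr rfl fun j hj => ?_
      rw [show n - 1 - j + 1 = n - j by have := Finset.mem_range.1 hj; omega]
    rw [h1, h2, h3]
    have h4 : 0 ≤ w 0 * z D 0 := mul_nonneg (hw 0 (Nat.zero_le _)) (hz0 D 0 (Nat.zero_le _))
    have h5 : ∑ j ∈ Finset.range n, (∑ i ∈ Finset.range (j + 1), w i) *
          (batchWeight (fun i => (α i : ℝ)) n j * z D (n - j)) ≤
        ∑ j ∈ Finset.range n, w (n - j) * z D (n - j) := by
      refine Finset.sum_le_sum fun j hj => ?_
      have hj := Finset.mem_range.1 hj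
      rw [← mul_assoc]
      refine mul_le_mul_of_nonneg_right ?_ (hz0 D _ (Nat.sub_le _ _))
      have h6 : (α j * α (n - j) : ℝ) < 1 := by exact_mod_cast hlt j hj
      rw [batchWeight, mul_div_assoc', div_le_iff₀ (by linarith)]
      linarith [hbatch j hj]
    linarith
  have hbound : ∀ D : ℕ, ∑ i ∈ Finset.range (n + 1), w i * z D i ≤
      D * c + ∑ i ∈ Finset.range (n + 1), w i * z 0 i := by
    intro D
    induction D with
    | zero => simp
    | succ D ih =>
      push_cast
      linarith [hdec D]
  obtain ⟨D, hD⟩ := exists_nat_gt ((∑ i ∈ Finset.range (n + 1), w i * z 0 i) / (-c))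
  rw [div_lt_iff₀ (by linarith)] at hD
  have h7 : 0 ≤ ∑ i ∈ Finset.range (n + 1), w i * z D i := Finset.sum_nonneg fun i hi => by
    have hi := Nat.lt_succ_iff.1 (Finset.mem_range.1 hi)
    exact mul_nonneg (hw i hi) (hz0 D i hi)
  linarith [hbound D]

/-- The levels need not be rational if the inequalities are strict. -/
theorem not_isCompetitive_of_real_weights {Γ : ℝ} (hΓ : 0 ≤ Γ) {α : ℕ → ℝ} {n : ℕ}
    (hpos : ∀ i ≤ n, 0 < α i) (hanti : ∀ i < n, α (i + 1) < α i)
    (hlt : ∀ j < n, α j * α (n - j) < 1) {w : ℕ → ℝ} (hw : ∀ i ≤ n, 0 ≤ w i)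
    (hbatch : ∀ j < n, (α j - α (j + 1)) * α j * ∑ i ∈ Finset.range (j + 1), w i <
      w (n - j) * (1 - α j * α (n - j)))
    (hneg : ∑ i ∈ Finset.range (n + 1), w i * (1 - Γ - Γ * α i + α n) < 0) :
    ¬ A.IsCompetitive Γ := by
  -- Only finitely many coordinates are involved, so the strict inequalities are open in the product
  -- topology, where rational sequences are dense.
  have hopen : ∀ᶠ β : ℕ → ℝ in nhds α, (∀ i ∈ Finset.range (n + 1), 0 < β i) ∧
      (∀ i ∈ Finset.range n, β (i + 1) < β i) ∧
      (∀ j ∈ Finset.range n, β j * β (n - j) < 1) ∧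
      (∀ j ∈ Finset.range n, (β j - β (j + 1)) * β j * ∑ i ∈ Finset.range (j + 1), w i <
        w (n - j) * (1 - β j * β (n - j))) ∧
      ∑ i ∈ Finset.range (n + 1), w i * (1 - Γ - Γ * β i + β n) < 0 := by
    have hc : ∀ i, Filter.Tendsto (fun β : ℕ → ℝ => β i) (nhds α) (nhds (α i)) := fun i =>
      (continuous_apply i).continuousAt
    refine Filter.Eventually.and ?_ (Filter.Eventually.and ?_ (Filter.Eventually.and ?_
      (Filter.Eventually.and ?_ ?_)))
    · rw [Filter.eventually_all_finset]
      exact fun i hi => (hc i).eventually (lt_mem_nhds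
        (hpos i (Nat.lt_succ_iff.1 (Finset.mem_range.1 hi))))
    · rw [Filter.eventually_all_finset]
      exact fun i hi => (hc (i + 1)).eventually_lt (hc i) (hanti i (Finset.mem_range.1 hi))
    · rw [Filter.eventually_all_finset]
      exact fun i hi => ((hc i).mul (hc (n - i))).eventually (gt_mem_nhds
        (hlt i (Finset.mem_range.1 hi)))
    · rw [Filter.eventually_all_finset]
      refine fun j hj => Filter.Tendsto.eventually_lt ?_ ?_ (hbatch j (Finset.mem_range.1 hj))
      · exact (((hc j).sub (hc (j + 1))).mul (hc j)).mul_const _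
      · exact (((hc j).mul (hc (n - j))).const_sub 1).const_mul _
    · refine Filter.Tendsto.eventually (tendsto_finsetSum _ fun i _ => ?_) (gt_mem_nhds hneg)
      exact ((((hc i).const_mul Γ).const_sub (1 - Γ)).add (hc n)).const_mul _
  have hdense : DenseRange (Pi.map fun (_ : ℕ) (q : ℚ) => (q : ℝ)) :=
    DenseRange.piMap fun _ => Rat.denseRange_cast
  obtain ⟨β, h1, h2, h3, h4, h5⟩ := hdense.exists_mem_open isOpen_interior
    ⟨α, mem_interior_iff_mem_nhds.2 hopen⟩ |>.imp fun β hβ => interior_subset hβ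
  simp only [Pi.map_apply, Finset.mem_range] at h1 h2 h3 h4 h5
  refine not_isCompetitive_of_weights hΓ (α := β) (n := n) (fun i hi => ?_) (fun i hi => ?_)
    (fun j hj => ?_) hw (fun j hj => (h4 j hj).le) h5
  · exact_mod_cast h1 i (Nat.lt_succ_of_le hi)
  · exact_mod_cast h2 i hi
  · exact_mod_cast h3 j hj

end OnlineAlgorithm

/-! ### Derandomization by taking expectations. -/

namespace RandomizedAlgorithm

theorem _root_.DecisionRule.output_castSucc_last (D : DecisionRule) (t : ℕ) (I : Instance (t + 1)) (u : Fin t) :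
    D.output I u.castSucc (Fin.last t) = D t I u := by
  rw [DecisionRule.output, dif_pos (Fin.castSucc_lt_last u)]
  rfl

variable {Ω : Type*} [MeasurableSpace Ω] (R : RandomizedAlgorithm Ω) (μ : Measure Ω)

theorem _root_.OnlineAlgorithm.output_le_one (A : OnlineAlgorithm) {n : ℕ} (I : Instance n) (u v : Fin n) :
    A.rule.output I u v ≤ 1 :=
  (Finset.single_le_sum (fun w _ => (A.feasible n I).nonneg w v) (Finset.mem_univ u)).trans
    ((A.feasible n I).sum_le_one v)

theorem integrable_rule [IsProbabilityMeasure μ] (t : ℕ) (I : Instance (t + 1)) (u : Fin t) :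
    Integrable (fun ω => (R.alg ω).rule t I u) μ := by
  refine Integrable.of_bound (R.measurable_rule t I u).aestronglyMeasurable 1
    (Filter.Eventually.of_forall fun ω => ?_)
  rw [← DecisionRule.output_castSucc_last (R.alg ω).rule, Real.norm_of_nonneg (((R.alg ω).feasible _ I).nonneg _ _)]
  exact (R.alg ω).output_le_one _ _ _

theorem integrable_output [IsProbabilityMeasure μ] {n : ℕ} (I : Instance n) (u v : Fin n) :
    Integrable (fun ω => (R.alg ω).rule.output I u v) μ := by
  unfold DecisionRule.output
  split_ifs
  · exact R.integrable_rule μ _ _ _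
  · exact R.integrable_rule μ _ _ _
  · exact integrable_const 0

/-- The expected decisions of a randomized algorithm. -/
noncomputable def expectedRule : DecisionRule := fun t I u => ∫ ω, (R.alg ω).rule t I u ∂μ

theorem output_expectedRule {n : ℕ} (I : Instance n) (u v : Fin n) :
    (R.expectedRule μ).output I u v = ∫ ω, (R.alg ω).rule.output I u v ∂μ := by
  unfold DecisionRule.output
  split_ifs
  · rfl
  · rfl
  · simp

/-- The deterministic algorithm that takes the expected decisions of a randomized algorithm. -/
noncomputable def expectation [IsProbabilityMeasure μ] : OnlineAlgorithm where
  rule := R.expectedRule μ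
  feasible n I :=
    { symm := fun u v => by
        simp only [output_expectedRule]
        exact integral_congr_ae (Filter.Eventually.of_forall fun ω =>
          ((R.alg ω).feasible n I).symm u v)
      nonneg := fun u v => by
        rw [output_expectedRule]
        exact integral_nonneg fun ω => ((R.alg ω).feasible n I).nonneg u v
      eq_zero := fun u v huv => by
        rw [output_expectedRule]
        simp [((R.alg _).feasible n I).eq_zero u v huv]
      sum_le_one := fun v => by
        simp only [output_expectedRule]
        rw [← integral_finsetSum _ fun u _ => R.integrable_output μ I u v]
        calc ∫ ω, ∑ u, (R.alg ω).rule.output I u v ∂μ ≤ ∫ _, (1 : ℝ) ∂μ :=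
              integral_mono (integrable_finsetSum _ fun u _ => R.integrable_output μ I u v)
                (integrable_const 1) fun ω => ((R.alg ω).feasible n I).sum_le_one v
          _ = 1 := by simp }

theorem size_expectation [IsProbabilityMeasure μ] {n : ℕ} (I : Instance n) :
    (R.expectation μ).size I = ∫ ω, (R.alg ω).size I ∂μ := by
  simp only [OnlineAlgorithm.size, expectation, output_expectedRule]
  rw [integral_div, integral_finsetSum _ fun v _ =>
    integrable_finsetSum _ fun u _ => R.integrable_output μ I u v]
  congr 1
  exact Finset.sum_congr rfl fun v _ =>
    (integral_finsetSum _ fun u _ => R.integrable_output μ I u v).symm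

theorem IsCompetitive.expectation {R : RandomizedAlgorithm Ω} {μ : Measure Ω}
    [IsProbabilityMeasure μ] {Γ : ℝ} (h : R.IsCompetitive μ Γ) :
    (R.expectation μ).IsCompetitive Γ := fun n I => by
  rw [size_expectation]
  exact h n I

end RandomizedAlgorithm

/-! ### The continuous levels and weights. -/

/-- Uniform continuity in multiplicative form; it lets mean value points be replaced by grid points
at the cost of a factor `r`. -/
theorem IsCompact.exists_mul_lt_of_dist_lt {s : Set ℝ} (hs : IsCompact s) {F : ℝ → ℝ}
    (hF : ContinuousOn F s) (hpos : ∀ x ∈ s, 0 < F x) {r : ℝ} (hr : r < 1) :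
    ∃ δ > 0, ∀ x ∈ s, ∀ y ∈ s, |x - y| < δ → r * F x < F y := by
  rcases s.eq_empty_or_nonempty with rfl | hne
  · exact ⟨1, one_pos, by simp⟩
  obtain ⟨x₀, hx₀, hmin⟩ := hs.exists_isMinOn hne hF
  obtain ⟨δ, hδ, h⟩ := Metric.uniformContinuousOn_iff.1 (hs.uniformContinuousOn_of_continuous hF)
    ((1 - r) * F x₀) (mul_pos (by linarith) (hpos x₀ hx₀))
  refine ⟨δ, hδ, fun x hx y hy hxy => ?_⟩
  have h1 := h x hx y hy hxy
  rw [Real.dist_eq] at h1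
  have h2 := (abs_lt.1 h1).2
  have h3 : F x₀ ≤ F x := hmin hx
  nlinarith

namespace HardInstance

open Real

/-- The level function: an active vertex with parameter `u` has dual weight `1 / (1 + level k u)`. -/
noncomputable def level (k u : ℝ) : ℝ := exp (u / k) * (cosh u / k - sinh u)

/-- The distribution function of the parameters of the active vertices. -/
noncomputable def mass (k u : ℝ) : ℝ := exp (-(u / k)) * (u / cosh u + k * cosh u + sinh u)

/-- An antiderivative of the product of `level` with the derivative of `mass`. -/
noncomputable def levelMass (k u : ℝ) : ℝ :=
  (1 - 1 / k ^ 2) * (u ^ 2 + sinh u ^ 2) / 2 - u * tanh u + (u + sinh u * cosh u) / (2 * k) +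
    k * (u - sinh u * cosh u) / 2

/-- The derivative of `mass`. -/
noncomputable def massDeriv (k u : ℝ) : ℝ := exp (-(u / k)) * level k (-u) / cosh u * mass k (-u)

variable {k : ℝ}

theorem continuous_level : Continuous (level k) := by unfold level; fun_prop

theorem continuous_mass : Continuous (mass k) := by
  unfold mass
  have : ∀ u, cosh u ≠ 0 := fun u => (cosh_pos u).ne'
  fun_prop (disch := assumption)

theorem continuous_levelMass : Continuous (levelMass k) := by
  unfold levelMass
  simp only [tanh_eq_sinh_div_cosh]
  have : ∀ u, cosh u ≠ 0 := fun u => (cosh_pos u).ne'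
  fun_prop (disch := assumption)

theorem hasDerivAt_exp_div (u : ℝ) : HasDerivAt (fun u => exp (u / k)) (exp (u / k) * (1 / k)) u :=
  ((hasDerivAt_id u).div_const k).exp

theorem hasDerivAt_level (u : ℝ) :
    HasDerivAt (level k) (-((1 - 1 / k ^ 2) * exp (u / k) * cosh u)) u := by
  have h := (hasDerivAt_exp_div (k := k) u).mul
    (((hasDerivAt_cosh u).div_const k).sub (hasDerivAt_sinh u))
  refine h.congr_deriv ?_
  simp only [Pi.sub_apply]
  ring

/-- The factor `1 - 1 / k ^ 2` also occurs in the derivative of `level`, so it cancels in the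
continuous batch condition. -/
theorem one_sub_level_mul_level (u : ℝ) :
    1 - level k u * level k (-u) = (1 - 1 / k ^ 2) * cosh u ^ 2 := by
  have h1 : exp (u / k) * exp (-u / k) = 1 := by
    rw [← exp_add, neg_div, add_neg_cancel, exp_zero]
  have h2 := cosh_sq u
  have h3 : level k u * level k (-u) =
      exp (u / k) * exp (-u / k) * (cosh u ^ 2 / k ^ 2 - sinh u ^ 2) := by
    rw [level, level, cosh_neg, sinh_neg]
    ring
  rw [h3, h1]
  linear_combination -h2

/-- With the two preceding lemmas, this is the batch condition with equality in the continuum: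
`-level' u * level u * mass u = mass' (-u) * (1 - level u * level (-u))`. -/
theorem hasDerivAt_mass (hk : k ≠ 0) (u : ℝ) : HasDerivAt (mass k) (massDeriv k u) u := by
  have hc := (cosh_pos u).ne'
  have h := (((hasDerivAt_id u).div_const k).neg.exp).mul
    ((((hasDerivAt_id u).div (hasDerivAt_cosh u) hc).add
      ((hasDerivAt_cosh u).const_mul k)).add (hasDerivAt_sinh u))
  refine h.congr_deriv ?_
  have h1 : exp (u / k) * exp (-(u / k)) = 1 := by
    rw [← exp_add, add_neg_cancel, exp_zero]
  have h2 : massDeriv k u = exp (u / k) * exp (-(u / k)) * (exp (-(u / k)) *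
      ((cosh u / k + sinh u) / cosh u * (-u / cosh u + k * cosh u - sinh u))) := by
    rw [massDeriv, level, mass, cosh_neg, sinh_neg, neg_div, neg_neg]
    ring
  rw [h2, h1, one_mul]
  simp only [id, Pi.add_apply, Pi.neg_apply, Pi.div_apply]
  have h3 := cosh_sq u
  generalize exp (-(u / k)) = e
  field_simp
  linear_combination (-e * k * cosh u) * h3

theorem hasDerivAt_levelMass (hk : k ≠ 0) (u : ℝ) :
    HasDerivAt (levelMass k) (level k u * massDeriv k u) u := by
  have hc := (cosh_pos u).ne'
  have htanh : HasDerivAt tanh (1 / cosh u ^ 2) u := by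
    have := (hasDerivAt_sinh u).div (hasDerivAt_cosh u) hc
    have e : tanh = sinh / cosh := funext fun x => tanh_eq_sinh_div_cosh x
    rw [e]
    refine this.congr_deriv ?_
    congr 1
    linear_combination cosh_sq u
  have hsc := (hasDerivAt_sinh u).mul (hasDerivAt_cosh u)
  have h := ((((((hasDerivAt_pow 2 u).add ((hasDerivAt_sinh u).pow 2)).const_mul
    (1 - 1 / k ^ 2)).div_const 2).sub ((hasDerivAt_id u).mul htanh)).add
    (((hasDerivAt_id u).add hsc).div_const (2 * k))).add
    ((((hasDerivAt_id u).sub hsc).const_mul k).div_const 2)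
  refine h.congr_deriv ?_
  have h1 : exp (u / k) * exp (-(u / k)) = 1 := by
    rw [← exp_add, add_neg_cancel, exp_zero]
  have h2 : level k u * massDeriv k u = (exp (u / k) * exp (-(u / k))) ^ 2 *
      (cosh u / k - sinh u) * (cosh u / k + sinh u) / cosh u *
        (-u / cosh u + k * cosh u - sinh u) := by
    rw [massDeriv, level, level, mass, cosh_neg, sinh_neg, neg_div, neg_neg]
    ring
  rw [h2, h1, tanh_eq_sinh_div_cosh]
  simp only [id]
  have h3 := cosh_sq u
  field_simp
  push_cast
  linear_combination (2 * k ^ 2 * u + 2 * k ^ 2 * sinh u * cosh u - k * cosh u ^ 2 -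
    k ^ 3 * cosh u ^ 2) * h3

section critical

variable (hk : 1 < k) (hcosh : cosh k = k * sinh k)
include hk

theorem one_sub_inv_sq_pos : 0 < 1 - 1 / k ^ 2 := by
  rw [sub_pos, div_lt_one (by positivity)]
  nlinarith

theorem level_strictAnti : StrictAnti (level k) := by
  refine strictAnti_of_hasDerivAt_neg hasDerivAt_level fun u => ?_
  have := one_sub_inv_sq_pos hk
  have := cosh_pos u
  rw [neg_lt_zero]
  positivity

include hcosh

theorem level_self : level k k = 0 := by
  have : k ≠ 0 := by linarith
  rw [level, hcosh]
  field_simp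
  simp

theorem level_pos {u : ℝ} (hu : u < k) : 0 < level k u := by
  rw [← level_self hk hcosh]
  exact level_strictAnti hk hu

theorem mass_neg_self : mass k (-k) = 0 := by
  have h0 : k ≠ 0 := by linarith
  have hs : 0 < sinh k := sinh_pos_iff.2 (by linarith)
  have h1 := cosh_sq k
  rw [mass, cosh_neg, sinh_neg]
  have h2 : -k / cosh k + k * cosh k + -sinh k = 0 := by
    rw [hcosh] at h1 ⊢
    field_simp
    linear_combination h1
  rw [h2, mul_zero]

theorem mass_pos {u : ℝ} (hu : -k < u) : 0 < mass k u := by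
  have h0 : 0 < k := by linarith
  -- This is `mass` without its positive factor `exp (-(u / k)) / cosh u`. Its derivative is `2 *
  -- cosh x * (cosh x + k * sinh x)`, whose sign is that of `level k (-x)`.
  have hφ : StrictMonoOn (fun u => u + k * cosh u ^ 2 + sinh u * cosh u) (Set.Ici (-k)) := by
    refine strictMonoOn_of_hasDerivWithinAt_pos (convex_Ici _) (by fun_prop)
      (f' := fun x => 1 + k * (2 * cosh x * sinh x) + (cosh x * cosh x + sinh x * sinh x)) ?_ ?_
    · intro x _
      refine HasDerivAt.hasDerivWithinAt ?_
      refine (((hasDerivAt_id x).add (((hasDerivAt_cosh x).pow 2).const_mul k)).add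
        ((hasDerivAt_sinh x).mul (hasDerivAt_cosh x))).congr_deriv ?_
      simp
    · intro x hx
      rw [interior_Ici, Set.mem_Ioi] at hx
      have h1 : 0 < level k (-x) := level_pos hk hcosh (by linarith)
      rw [level, cosh_neg, sinh_neg] at h1
      have h2 := pos_of_mul_pos_right h1 (exp_pos _).le
      have h3 : 0 < cosh x + k * sinh x := by
        have : cosh x + k * sinh x = k * (cosh x / k - -sinh x) := by field_simp; ring
        rw [this]
        positivity
      have h4 : 1 + k * (2 * cosh x * sinh x) + (cosh x * cosh x + sinh x * sinh x) =
          2 * cosh x * (cosh x + k * sinh x) := by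
        linear_combination -(cosh_sq x)
      have := cosh_pos x
      show 0 < 1 + k * (2 * cosh x * sinh x) + (cosh x * cosh x + sinh x * sinh x)
      rw [h4]
      positivity
  have e : ∀ u, mass k u = exp (-(u / k)) / cosh u * (u + k * cosh u ^ 2 + sinh u * cosh u) := by
    intro u
    have := (cosh_pos u).ne'
    rw [mass]
    field_simp
  have h1 := hφ Set.self_mem_Ici hu.le hu
  have h2 := e (-k)
  rw [mass_neg_self hk hcosh] at h2
  have h3 : 0 < exp (-(-k / k)) / cosh (-k) := div_pos (exp_pos _) (cosh_pos _)
  have h4 := (mul_eq_zero.1 h2.symm).resolve_left h3.ne'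
  simp only [h4] at h1
  rw [e]
  exact mul_pos (div_pos (exp_pos _) (cosh_pos _)) h1

theorem mass_strictMonoOn : StrictMonoOn (mass k) (Set.Icc (-k) k) := by
  have h0 : k ≠ 0 := by linarith
  refine strictMonoOn_of_hasDerivWithinAt_pos (convex_Icc _ _) continuous_mass.continuousOn
    (fun x _ => (hasDerivAt_mass h0 x).hasDerivWithinAt) fun x hx => ?_
  rw [interior_Icc, Set.mem_Ioo] at hx
  have h1 : 0 < level k (-x) := level_pos hk hcosh (by linarith)
  have h2 : 0 < mass k (-x) := mass_pos hk hcosh (by linarith)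
  have := cosh_pos x
  unfold massDeriv
  positivity

/-- Since `level` decreases, its value at the left end bounds the integral of `level` against
`mass`. -/
theorem levelMass_sub_le {u v : ℝ} (hu : -k ≤ u) (huv : u ≤ v) (hv : v ≤ k) :
    levelMass k v - levelMass k u ≤ level k u * (mass k v - mass k u) := by
  have h0 : k ≠ 0 := by linarith
  have hmono : MonotoneOn (fun x => level k u * mass k x - levelMass k x) (Set.Icc u v) := by
    refine monotoneOn_of_hasDerivWithinAt_nonneg (convex_Icc _ _)
      ((continuous_mass.const_mul _).sub continuous_levelMass).continuousOn
      (fun x _ => (((hasDerivAt_mass h0 x).const_mul _).sub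
        (hasDerivAt_levelMass h0 x)).hasDerivWithinAt) fun x hx => ?_
    rw [interior_Icc, Set.mem_Ioo] at hx
    have h1 : 0 < level k (-x) := level_pos hk hcosh (by linarith)
    have h2 : 0 < mass k (-x) := mass_pos hk hcosh (by linarith)
    have h3 : level k x ≤ level k u := (level_strictAnti hk).antitone hx.1.le
    have h4 : 0 ≤ massDeriv k x := by
      have := cosh_pos x
      unfold massDeriv
      positivity
    rw [← sub_mul]
    exact mul_nonneg (by linarith) h4
  have := hmono ⟨le_rfl, huv⟩ ⟨huv, le_rfl⟩ huv
  simp only at this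
  linarith

/-- Together with `mul_mass_self` this gives the threshold: `(1 - Γ) * mass k k < Γ * k ^ 2` is the
negativity condition in the limit. -/
theorem levelMass_total : levelMass k k - levelMass k (-k) = k ^ 2 := by
  have h0 : k ≠ 0 := by linarith
  have h1 := cosh_sq k
  rw [levelMass, levelMass, cosh_neg, sinh_neg, tanh_eq_sinh_div_cosh, tanh_eq_sinh_div_cosh,
    cosh_neg, sinh_neg]
  rw [hcosh] at h1 ⊢
  field_simp
  linear_combination (-2 * k ^ 2) * h1

theorem mul_mass_self : exp 1 / (2 * sinh k) * mass k k = k ^ 2 := by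
  have h0 : k ≠ 0 := by linarith
  have hs : sinh k ≠ 0 := (sinh_pos_iff.2 (by linarith)).ne'
  have h1 := cosh_sq k
  have h2 : exp 1 * exp (-(k / k)) = 1 := by
    rw [div_self h0, ← exp_add, add_neg_cancel, exp_zero]
  have h3 : exp 1 / (2 * sinh k) * mass k k =
      exp 1 * exp (-(k / k)) * ((k / cosh k + k * cosh k + sinh k) / (2 * sinh k)) := by
    rw [mass]
    ring
  rw [h3, h2, one_mul]
  rw [hcosh] at h1 ⊢
  field_simp
  linear_combination -h1

end critical

end HardInstance

/-! ### Discretization of the continuous solution. -/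

namespace HardInstance

open Real

variable {k : ℝ}

theorem scaled_level_mul_le (hk : 1 < k) (hcosh : cosh k = k * sinh k) {τ x : ℝ} (hτ0 : 0 < τ)
    (hτ1 : τ < 1 / 2) (hx : -k < x) (hx' : x < k) :
    (1 - τ) * level k x * ((1 - τ) * level k (-x)) ≤ level k x * level k (-x) := by
  have h3 := level_pos hk hcosh hx'
  have h4 : 0 < level k (-x) := level_pos hk hcosh (by linarith)
  exact mul_le_mul (mul_le_of_le_one_left h3.le (by linarith))
    (mul_le_of_le_one_left h4.le (by linarith)) (mul_nonneg (by linarith) h4.le) h3.le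

theorem mass_neg_sub_mul {x y : ℝ} (hk : k ≠ 0) (hxy : x < y) : ∃ z ∈ Set.Ioo x y,
    (mass k (-x) - mass k (-y)) * (exp (-(z / k)) * cosh z) = (y - x) * level k z * mass k z := by
  obtain ⟨η, hη, hη'⟩ := exists_hasDerivAt_eq_slope (mass k) (massDeriv k) (neg_lt_neg hxy)
    continuous_mass.continuousOn fun x _ => hasDerivAt_mass hk x
  refine ⟨-η, ⟨by linarith [hη.2], by linarith [hη.1]⟩, ?_⟩
  rw [eq_div_iff (by linarith), massDeriv] at hη'
  rw [← hη', cosh_neg, neg_div, neg_neg]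
  have h1 : exp (η / k) * exp (-(η / k)) = 1 := by
    rw [← exp_add, add_neg_cancel, exp_zero]
  have h2 := (cosh_pos η).ne'
  calc exp (-(η / k)) * level k (-η) / cosh η * mass k (-η) * (-x - -y) * (exp (η / k) * cosh η)
      = exp (η / k) * exp (-(η / k)) * ((y - x) * level k (-η) * mass k (-η)) *
        (cosh η / cosh η) := by ring
    _ = (y - x) * level k (-η) * mass k (-η) := by rw [h1, div_self h2]; ring

theorem level_sub (k : ℝ) {x y : ℝ} (hxy : x < y) : ∃ z ∈ Set.Ioo x y,
    level k x - level k y = (y - x) * (1 - 1 / k ^ 2) * (exp (z / k) * cosh z) := by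
  obtain ⟨ξ, hξ, hξ'⟩ := exists_hasDerivAt_eq_slope (level k) _ hxy
    continuous_level.continuousOn fun x _ => hasDerivAt_level x
  refine ⟨ξ, hξ, ?_⟩
  rw [eq_div_iff (by linarith)] at hξ'
  linarith

/-- The mean value theorem compares the two sides up to three oscillation factors, while `mass k x ≤
mass k v` is favourable. Scaling the levels by `1 - τ` saves `(1 - τ) ^ 2`, which is at most `(1 - τ
/ 2) ^ 3` and so absorbs the oscillation. -/
theorem batch_lt (hk : 1 < k) (hcosh : cosh k = k * sinh k) {τ x y : ℝ} (hτ0 : 0 < τ)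
    (hτ1 : τ < 1 / 2) (hx : -k < x) (hxy : x < y) (hy : y < k)
    (hosc : ∀ z ∈ Set.Ioo x y,
      (1 - τ / 2) * (exp (z / k) * cosh z) < exp (x / k) * cosh x ∧
      (1 - τ / 2) * level k x < level k z ∧
      (1 - τ / 2) * (exp (-(z / k)) * cosh z) < exp (-(x / k)) * cosh x) :
    ((1 - τ) * level k x - (1 - τ) * level k y) * ((1 - τ) * level k x) * mass k x <
      (mass k (-x) - mass k (-y)) * (1 - (1 - τ) * level k x * ((1 - τ) * level k (-x))) := by
  obtain ⟨ξ, hξ, hlevdiff⟩ := level_sub k hxy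
  obtain ⟨v, hv, hmassdiff⟩ := mass_neg_sub_mul (k := k) (by linarith) hxy
  have f1 := (hosc ξ hξ).1
  have f2 := (hosc v hv).2.1
  have f3 := (hosc v hv).2.2
  have hlevu := level_pos hk hcosh (hxy.trans hy)
  have hlevv := level_pos hk hcosh (hv.2.trans hy)
  have hmu := mass_pos hk hcosh hx
  have hmono : mass k x ≤ mass k v :=
    (mass_strictMonoOn hk hcosh).monotoneOn ⟨hx.le, (hxy.trans hy).le⟩
      ⟨(hx.trans hv.1).le, (hv.2.trans hy).le⟩ hv.1.le
  have hwpos : 0 ≤ mass k (-x) - mass k (-y) := by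
    rw [sub_nonneg]
    exact (mass_strictMonoOn hk hcosh).monotoneOn ⟨by linarith, by linarith⟩
      ⟨by linarith, by linarith⟩ (by linarith)
  have hc' := one_sub_inv_sq_pos hk
  have hone : (1 - 1 / k ^ 2) * cosh x ^ 2 ≤
      1 - (1 - τ) * level k x * ((1 - τ) * level k (-x)) := by
    rw [← one_sub_level_mul_level]
    linarith [scaled_level_mul_le hk hcosh hτ0 hτ1 hx (hxy.trans hy)]
  have hE : 0 < exp (ξ / k) * cosh ξ := mul_pos (exp_pos _) (cosh_pos _)
  have hC : 0 < exp (-(v / k)) * cosh v := mul_pos (exp_pos _) (cosh_pos _)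
  have hcx : exp (x / k) * cosh x * (exp (-(x / k)) * cosh x) = cosh x ^ 2 := by
    have h1 : exp (x / k) * exp (-(x / k)) = 1 := by
      rw [← exp_add, add_neg_cancel, exp_zero]
    linear_combination cosh x ^ 2 * h1
  refine lt_of_lt_of_le ?_ (mul_le_mul_of_nonneg_left hone hwpos)
  refine lt_of_mul_lt_mul_right ?_ hC.le
  rw [← hcx, mul_right_comm (mass k (-x) - mass k (-y)), hmassdiff, ← mul_sub, hlevdiff]
  have hd : 0 < y - x := sub_pos.2 hxy
  generalize exp (ξ / k) * cosh ξ = E at *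
  generalize exp (-(v / k)) * cosh v = C at *
  generalize exp (x / k) * cosh x = E' at *
  generalize exp (-(x / k)) * cosh x = C' at *
  generalize level k x = L at *
  generalize level k v = L' at *
  generalize mass k x = m at *
  generalize mass k v = m' at *
  generalize 1 - 1 / k ^ 2 = c at *
  generalize y - x = d at *
  have hr : 0 < 1 - τ / 2 := by linarith
  have hprod : (1 - τ / 2) ^ 3 * (E * L * C) < E' * L' * C' := by
    have h2 := mul_lt_mul'' (mul_lt_mul'' f1 f2 (by positivity) (by positivity)) f3
      (by positivity) (by positivity)
    linarith
  have hτr : (1 - τ) ^ 2 ≤ (1 - τ / 2) ^ 3 := by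
    nlinarith [mul_pos hτ0 (by linarith : 0 < 1 / 2 - τ), pow_pos hτ0 3]
  have h3 : (1 - τ) ^ 2 * (E * L * C) ≤ (1 - τ / 2) ^ 3 * (E * L * C) :=
    mul_le_mul_of_nonneg_right hτr (by positivity)
  have h4 : m * ((1 - τ) ^ 2 * (E * L * C)) < m' * (E' * L' * C') :=
    mul_lt_mul' hmono (h3.trans_lt hprod) (mul_nonneg (sq_nonneg _) (by positivity)) (by linarith)
  have h5 := mul_lt_mul_of_pos_left h4 (mul_pos hd hc')
  linarith

/-- No algorithm beats the ratio `1 / (1 + exp 1 / (2 * sinh k))` if `k` is the positive solution of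
`coth k = k`. -/
theorem not_isCompetitive (hk : 1 < k) (hcosh : cosh k = k * sinh k) {Γ : ℝ}
    (hΓ : 1 / (1 + exp 1 / (2 * sinh k)) < Γ) (A : OnlineAlgorithm) : ¬ A.IsCompetitive Γ := by
  have hs : 0 < sinh k := sinh_pos_iff.2 (by linarith)
  have hf : 0 < exp 1 / (2 * sinh k) := div_pos (exp_pos _) (by linarith)
  have hΓ0 : 0 < Γ := lt_trans (by positivity) hΓ
  have hgk : 0 < mass k k := mass_pos hk hcosh (by linarith)
  -- the parameter range `[-c, c]` and the scaling of the levels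
  obtain ⟨τ, hτ0, hτ1, hneg⟩ : ∃ τ > 0, τ < 1 / 2 ∧
      (1 - Γ + (1 - τ) * level k (k - τ)) * mass k (k - τ) -
        Γ * (1 - τ) * (levelMass k (k - τ) - levelMass k (-(k - τ)) - τ * mass k (k - τ)) < 0 := by
    have hcont : Continuous fun τ : ℝ => (1 - Γ + (1 - τ) * level k (k - τ)) * mass k (k - τ) -
        Γ * (1 - τ) * (levelMass k (k - τ) - levelMass k (-(k - τ)) - τ * mass k (k - τ)) := by
      have h1 := continuous_level (k := k)
      have h2 := continuous_mass (k := k)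
      have h3 := continuous_levelMass (k := k)
      fun_prop
    have h0 : (1 - Γ + (1 - 0) * level k (k - 0)) * mass k (k - 0) -
        Γ * (1 - 0) * (levelMass k (k - 0) - levelMass k (-(k - 0)) - 0 * mass k (k - 0)) < 0 := by
      simp only [sub_zero, zero_mul, mul_one, level_self hk hcosh, levelMass_total hk hcosh]
      rw [div_lt_iff₀ (by linarith)] at hΓ
      rw [← mul_mass_self hk hcosh]
      nlinarith
    have h := (hcont.tendsto 0).eventually (gt_mem_nhds h0)
    obtain ⟨τ, h1, h2⟩ := ((h.filter_mono nhdsWithin_le_nhds).and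
      (Ioo_mem_nhdsGT (show (0 : ℝ) < 1 / 2 by norm_num))).exists
    exact ⟨τ, h2.1, h2.2, h1⟩
  set c := k - τ with hc
  have hc0 : 0 < c := by linarith
  have hIcc : ∀ {x}, x ∈ Set.Icc (-c) c → -k < x ∧ x < k := fun hx =>
    ⟨by linarith [hx.1], by linarith [hx.2]⟩
  -- the mesh width
  obtain ⟨δ₁, hδ₁, hlev⟩ := (isCompact_Icc (a := -c) (b := c)).exists_mul_lt_of_dist_lt
    continuous_level.continuousOn (fun x hx => level_pos hk hcosh (hIcc hx).2)
    (show 1 - τ / 2 < 1 by linarith)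
  obtain ⟨δ₂, hδ₂, hexp₁⟩ := (isCompact_Icc (a := -c) (b := c)).exists_mul_lt_of_dist_lt
    (F := fun x => exp (x / k) * cosh x) (by fun_prop)
    (fun x _ => mul_pos (exp_pos _) (cosh_pos _)) (show 1 - τ / 2 < 1 by linarith)
  obtain ⟨δ₃, hδ₃, hexp₂⟩ := (isCompact_Icc (a := -c) (b := c)).exists_mul_lt_of_dist_lt
    (F := fun x => exp (-(x / k)) * cosh x) (by fun_prop)
    (fun x _ => mul_pos (exp_pos _) (cosh_pos _)) (show 1 - τ / 2 < 1 by linarith)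
  obtain ⟨δ₄, hδ₄, hunif⟩ := Metric.uniformContinuousOn_iff.1
    ((isCompact_Icc (a := -c) (b := c)).uniformContinuousOn_of_continuous
      (continuous_level (k := k)).continuousOn) τ hτ0
  set δ := min (min δ₁ δ₂) (min δ₃ δ₄) with hδdef
  have hδ : 0 < δ := lt_min (lt_min hδ₁ hδ₂) (lt_min hδ₃ hδ₄)
  obtain ⟨n, hn⟩ := exists_nat_gt (2 * c / δ)
  have hn0 : (0 : ℝ) < n := lt_trans (by positivity) hn
  set h := 2 * c / n with hh
  have hh0 : 0 < h := by positivity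
  have hhδ : h < δ := by
    rw [div_lt_iff₀ hδ] at hn
    rw [hh, div_lt_iff₀ hn0]
    linarith
  have hhn : n * h = 2 * c := by
    rw [hh]
    field_simp
  set u : ℕ → ℝ := fun i => -c + i * h with hu
  have hu0 : u 0 = -c := by simp [hu]
  have hun : u n = c := by simp only [hu]; linarith
  have husucc : ∀ i, u (i + 1) = u i + h := fun i => by
    simp only [hu]
    push_cast
    ring
  have hureflect : ∀ j ≤ n, u (n - j) = -u j := fun j hj => by
    simp only [hu]
    rw [Nat.cast_sub hj]
    linarith
  have huIcc : ∀ i ≤ n, u i ∈ Set.Icc (-c) c := fun i hi => by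
    have h1 : (i : ℝ) * h ≤ n * h := mul_le_mul_of_nonneg_right (by exact_mod_cast hi) hh0.le
    have h2 : 0 ≤ (i : ℝ) * h := by positivity
    exact ⟨by simp only [hu]; linarith, by simp only [hu]; linarith⟩
  -- Increments of `mass`, with an atom at index `0` because `mass` is positive at the truncated end
  -- `-c`; the partial sums are then values of `mass`.
  set w : ℕ → ℝ := fun i => if i = 0 then mass k (u 0) else mass k (u i) - mass k (u (i - 1))
    with hw
  have hw0 : w 0 = mass k (u 0) := by simp [hw]
  have hwsucc : ∀ i, w (i + 1) = mass k (u (i + 1)) - mass k (u i) := fun i => by simp [hw]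
  have hsum : ∀ j, ∑ i ∈ Finset.range (j + 1), w i = mass k (u j) := by
    intro j
    induction j with
    | zero => simp [hw0]
    | succ j ih => rw [Finset.sum_range_succ, ih, hwsucc]; ring
  have hmassu : ∀ i ≤ n, 0 < mass k (u i) := fun i hi =>
    mass_pos hk hcosh (hIcc (huIcc i hi)).1
  have hwnonneg : ∀ i ≤ n, 0 ≤ w i := by
    intro i hi
    rcases i with _ | i
    · rw [hw0]
      exact (hmassu 0 hi).le
    · have h1 := hIcc (huIcc i (by omega))
      have h2 := hIcc (huIcc (i + 1) hi)
      rw [hwsucc, sub_nonneg]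
      refine (mass_strictMonoOn hk hcosh).monotoneOn ⟨h1.1.le, h1.2.le⟩ ⟨h2.1.le, h2.2.le⟩ ?_
      rw [husucc]
      linarith
  have hweighted : ∀ j ≤ n, levelMass k (u j) - levelMass k (u 0) - τ * mass k (u j) ≤
      ∑ i ∈ Finset.range (j + 1), w i * level k (u i) := by
    intro j hj
    induction j with
    | zero =>
      have h1 := hmassu 0 hj
      have h2 := level_pos hk hcosh (hIcc (huIcc 0 hj)).2
      rw [Finset.sum_range_one, hw0]
      nlinarith [mul_pos h1 h2, mul_pos hτ0 h1]
    | succ j ih =>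
      have h1 := huIcc j (by omega)
      have h2 := huIcc (j + 1) hj
      have h3 := hunif _ h1 _ h2 (by
        rw [Real.dist_eq, husucc, show u j - (u j + h) = -h by ring, abs_neg, abs_of_pos hh0]
        exact hhδ.trans_le ((min_le_right _ _).trans (min_le_right _ _)))
      rw [Real.dist_eq] at h3
      have h4 := (abs_lt.1 h3).2
      have h5 := levelMass_sub_le hk hcosh (hIcc h1).1.le
        (by rw [husucc]; linarith : u j ≤ u (j + 1)) (hIcc h2).2.le
      have h6 := hwnonneg (j + 1) hj
      rw [Finset.sum_range_succ]
      rw [← hwsucc] at h5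
      have h7 := ih (by omega)
      have h8 := hwsucc j
      nlinarith [mul_le_mul_of_nonneg_left h4.le h6]
  refine OnlineAlgorithm.not_isCompetitive_of_real_weights hΓ0.le
    (α := fun i => (1 - τ) * level k (u i)) (n := n) (w := w) ?_ ?_ ?_ hwnonneg ?_ ?_
  · intro i hi
    exact mul_pos (by linarith) (level_pos hk hcosh (hIcc (huIcc i hi)).2)
  · intro i _
    refine mul_lt_mul_of_pos_left (level_strictAnti hk ?_) (by linarith)
    rw [husucc]
    linarith
  · intro j hj
    rw [hureflect j hj.le]
    have h1 := one_sub_level_mul_level (k := k) (u j)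
    have h2 := mul_pos (one_sub_inv_sq_pos hk) (pow_pos (cosh_pos (u j)) 2)
    linarith [scaled_level_mul_le hk hcosh hτ0 hτ1 (hIcc (huIcc j hj.le)).1
      (hIcc (huIcc j hj.le)).2]
  · intro j hj
    have hIj := huIcc j hj.le
    have hIj' := huIcc (j + 1) hj
    have hlt : u j < u (j + 1) := by rw [husucc]; linarith
    have hwj : w (n - j) = mass k (-u j) - mass k (-u (j + 1)) := by
      obtain ⟨i, hi⟩ : ∃ i, n - j = i + 1 := ⟨n - j - 1, by omega⟩
      rw [hi, hwsucc, ← hi, hureflect j hj.le, show i = n - (j + 1) by omega,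
        hureflect (j + 1) hj]
    rw [hsum, hureflect j hj.le, hwj]
    refine batch_lt hk hcosh hτ0 hτ1 (hIcc hIj).1 hlt (hIcc hIj').2 fun x hx => ?_
    have hIx : x ∈ Set.Icc (-c) c := ⟨hIj.1.trans hx.1.le, hx.2.le.trans hIj'.2⟩
    have hd : |x - u j| < δ := by
      have h1 := hx.2
      rw [husucc] at h1
      rw [abs_of_pos (by linarith [hx.1])]
      linarith
    refine ⟨hexp₁ x hIx (u j) hIj (hd.trans_le ((min_le_left _ _).trans (min_le_right _ _))),
      hlev (u j) hIj x hIx ?_,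
      hexp₂ x hIx (u j) hIj (hd.trans_le ((min_le_right _ _).trans (min_le_left _ _)))⟩
    rw [abs_sub_comm]
    exact hd.trans_le ((min_le_left _ _).trans (min_le_left _ _))
  · have h1 : ∑ i ∈ Finset.range (n + 1), w i * (1 - Γ - Γ * ((1 - τ) * level k (u i)) +
        (1 - τ) * level k (u n)) = (1 - Γ + (1 - τ) * level k (u n)) *
          ∑ i ∈ Finset.range (n + 1), w i -
        Γ * (1 - τ) * ∑ i ∈ Finset.range (n + 1), w i * level k (u i) := by
      rw [Finset.mul_sum, Finset.mul_sum, ← Finset.sum_sub_distrib]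
      exact Finset.sum_congr rfl fun i _ => by ring
    have h2 := hweighted n le_rfl
    rw [hu0, hun] at h2
    rw [h1, hsum, hun]
    have h3 : 0 ≤ Γ * (1 - τ) := mul_nonneg hΓ0.le (by linarith)
    have h4 := mul_le_mul_of_nonneg_left h2 h3
    linarith

end HardInstance

/-! ### The maximum of `ratioFun` and its numerical value. -/

namespace HardInstance

open Real

theorem exists_coth_eq_self :
    ∃ k : ℝ, 1.1993 < k ∧ k < 1.2 ∧ cosh k = k * sinh k := by
  -- The equation `coth k = k` in the form `k + 1 = (k - 1) * exp (2 * k)`.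
  have hcont : ContinuousOn (fun k : ℝ => (k + 1) - (k - 1) * exp (2 * k)) (Set.Icc 1.1993 1.2) := by
    fun_prop
  have h1 : (0 : ℝ) < 1.1993 + 1 - (1.1993 - 1) * exp (2 * 1.1993) := by
    have e1 : exp (2 * 1.1993) = exp 1 ^ 2 * exp 0.3986 := by
      rw [← exp_nat_mul, ← exp_add]
      norm_num
    have e2 : exp 0.3986 ≤ 1.49 := by
      refine (exp_bound' (by norm_num) (by norm_num) (n := 5) (by norm_num)).trans ?_
      norm_num [Finset.sum_range_succ, Nat.factorial]
    have e3 := exp_one_lt_d9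
    have e4 : exp 1 ^ 2 ≤ 2.7182818286 ^ 2 := pow_le_pow_left₀ (exp_pos 1).le e3.le 2
    have e5 : exp 1 ^ 2 * exp 0.3986 ≤ 2.7182818286 ^ 2 * 1.49 :=
      mul_le_mul e4 e2 (exp_pos _).le (by norm_num)
    rw [e1]
    norm_num at e5 ⊢
    linarith
  have h2 : (1.2 : ℝ) + 1 - (1.2 - 1) * exp (2 * 1.2) < 0 := by
    have e1 := sum_le_exp_of_nonneg (x := 2 * 1.2) (by norm_num) 10
    have e2 : (11 : ℝ) < ∑ i ∈ Finset.range 10, (2 * 1.2 : ℝ) ^ i / (i.factorial : ℝ) := by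
      norm_num [Finset.sum_range_succ, Nat.factorial]
    linarith
  obtain ⟨k, hk, hk0⟩ := intermediate_value_Ioo' (by norm_num) hcont ⟨h2, h1⟩
  refine ⟨k, hk.1, hk.2, ?_⟩
  have e1 : exp (2 * k) = exp k * exp k := by rw [← exp_add]; ring_nf
  have e2 : exp k * exp (-k) = 1 := by rw [← exp_add, add_neg_cancel, exp_zero]
  simp only [e1] at hk0
  rw [cosh_eq, sinh_eq]
  linear_combination exp (-k) / 2 * hk0 + (k - 1) / 2 * exp k * e2

/-- The convex function `x * log x` lies above its tangent line at `y`. -/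
theorem mul_log_add_sub_le {x y : ℝ} (hx : 0 ≤ x) (hy : 0 < y) :
    x * log y + x - y ≤ x * log x := by
  rcases hx.eq_or_lt with rfl | hx
  · simp [hy.le]
  · have h := log_le_sub_one_of_pos (div_pos hy hx)
    rw [log_div hy.ne' hx.ne'] at h
    have h2 := mul_le_mul_of_nonneg_left h hx.le
    have h3 : x * (y / x - 1) = y - x := by field_simp
    linarith

theorem ratioFun_eq {x : ℝ} (hx : 1 ≤ x) : ratioFun x =
    1 / (exp (((x + 1) / 2 * log ((x + 1) / 2) + (x - 1) / 2 * log ((x - 1) / 2)) / x) + 1) := by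
  have hx0 : x ≠ 0 := by linarith
  have h1 : ((x + 1) / 2) ^ ((x + 1) / (2 * x)) = exp ((x + 1) / 2 * log ((x + 1) / 2) / x) := by
    rw [rpow_def_of_pos (by linarith)]
    congr 1
    field_simp
  have h2 : ((x - 1) / 2) ^ ((x - 1) / (2 * x)) = exp ((x - 1) / 2 * log ((x - 1) / 2) / x) := by
    rcases hx.eq_or_lt with rfl | hx
    · simp
    · rw [rpow_def_of_pos (by linarith)]
      congr 1
      field_simp
  rw [ratioFun, h1, h2, ← exp_add, ← add_div]

theorem exp_one_sub_log {k : ℝ} (hk : 1 < k) :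
    exp (1 - log (2 * sinh k)) = exp 1 / (2 * sinh k) := by
  have hs : 0 < sinh k := sinh_pos_iff.2 (by linarith)
  rw [exp_sub, exp_log (by positivity)]

section critical

variable {k : ℝ} (hk : 1 < k) (hcosh : cosh k = k * sinh k)
include hk hcosh

theorem log_add_one_half : log ((k + 1) / 2) = k - log (2 * sinh k) := by
  have hs : 0 < sinh k := sinh_pos_iff.2 (by linarith)
  have h : (k + 1) / 2 = exp k / (2 * sinh k) := by
    rw [eq_div_iff (by positivity), ← cosh_add_sinh, hcosh]
    ring
  rw [h, log_div (exp_pos k).ne' (by positivity), log_exp]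

theorem log_sub_one_half : log ((k - 1) / 2) = -k - log (2 * sinh k) := by
  have hs : 0 < sinh k := sinh_pos_iff.2 (by linarith)
  have h : (k - 1) / 2 = exp (-k) / (2 * sinh k) := by
    rw [eq_div_iff (by positivity), ← cosh_sub_sinh, hcosh]
    ring
  rw [h, log_div (exp_pos _).ne' (by positivity), log_exp]

theorem ratioFun_critical : ratioFun k = 1 / (1 + exp 1 / (2 * sinh k)) := by
  have h0 : k ≠ 0 := by linarith
  rw [ratioFun_eq hk.le, log_add_one_half hk hcosh, log_sub_one_half hk hcosh,
    ← exp_one_sub_log hk, add_comm]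
  congr 3
  field_simp
  ring

/-- The tangent lines at `(k + 1) / 2` and `(k - 1) / 2` add up to exactly `x * (1 - log (2 * sinh
k))`, so dividing by `x` leaves a constant lower bound for the exponent. -/
theorem ratioFun_le {x : ℝ} (hx : 1 ≤ x) : ratioFun x ≤ 1 / (1 + exp 1 / (2 * sinh k)) := by
  rw [ratioFun_eq hx, ← exp_one_sub_log hk, add_comm]
  refine one_div_le_one_div_of_le (by positivity) (add_le_add_right (exp_le_exp.2 ?_) 1)
  rw [le_div_iff₀ (by linarith)]
  have h1 := mul_log_add_sub_le (x := (x + 1) / 2) (y := (k + 1) / 2) (by linarith) (by linarith)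
  have h2 := mul_log_add_sub_le (x := (x - 1) / 2) (y := (k - 1) / 2) (by linarith) (by linarith)
  rw [log_add_one_half hk hcosh] at h1
  rw [log_sub_one_half hk hcosh] at h2
  linarith

theorem isGreatest_ratioFun :
    IsGreatest (ratioFun '' Set.Ici 1) (1 / (1 + exp 1 / (2 * sinh k))) := by
  refine ⟨⟨k, hk.le, ratioFun_critical hk hcosh⟩, ?_⟩
  rintro _ ⟨x, hx, rfl⟩
  exact ratioFun_le hk hcosh hx

theorem abs_ratio_sub_lt (hlo : 1.1993 < k) (hhi : k < 1.2) :
    |1 / (1 + exp 1 / (2 * sinh k)) - 0.526| < 0.0005 := by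
  have hs : 0 < sinh k := sinh_pos_iff.2 (by linarith)
  set f := exp 1 / (2 * sinh k) with hf
  have hf0 : 0 < f := by positivity
  -- At the critical `k`, `1 / sinh k ^ 2 = k ^ 2 - 1`, so bounds on `k` and `exp 1` suffice.
  have hsq : f ^ 2 = exp 1 ^ 2 * (k ^ 2 - 1) / 4 := by
    have h1 := cosh_sq k
    rw [hcosh] at h1
    rw [hf]
    field_simp
    linear_combination -4 * h1
  have e1 := exp_one_gt_d9
  have e2 := exp_one_lt_d9
  have k1 : 1.1993 ^ 2 - 1 ≤ k ^ 2 - 1 := by nlinarith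
  have k2 : k ^ 2 - 1 ≤ 1.2 ^ 2 - 1 := by nlinarith
  have e3 : (2.7182818283 : ℝ) ^ 2 ≤ exp 1 ^ 2 := pow_le_pow_left₀ (by norm_num) e1.le 2
  have e4 : exp 1 ^ 2 ≤ (2.7182818286 : ℝ) ^ 2 := pow_le_pow_left₀ (exp_pos 1).le e2.le 2
  have h1 := mul_le_mul e3 k1 (by norm_num) (by positivity)
  have h2 := mul_le_mul e4 k2 (by nlinarith) (by norm_num)
  have f1 : 0.8994 < f := by
    refine lt_of_pow_lt_pow_left₀ 2 hf0.le ?_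
    rw [hsq]
    norm_num at h1 ⊢
    linarith
  have f2 : f < 0.9029 := by
    refine lt_of_pow_lt_pow_left₀ 2 (by norm_num) ?_
    rw [hsq]
    norm_num at h2 ⊢
    linarith
  rw [abs_lt]
  constructor
  · rw [lt_sub_iff_add_lt, lt_div_iff₀ (by linarith)]
    linarith
  · rw [sub_lt_iff_lt_add, div_lt_iff₀ (by linarith)]
    linarith

end critical

end HardInstance

theorem theorem1 :
    IsGreatest (ratioFun '' Set.Ici 1) gammaStar ∧
    |gammaStar - 0.526| < 0.0005 ∧
    ∀ c : ℝ, 0 < c →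
      (∀ A : OnlineAlgorithm, ¬ A.IsCompetitive (gammaStar + c)) ∧
      (∀ (Ω : Type*) [MeasurableSpace Ω] (μ : Measure Ω) [IsProbabilityMeasure μ]
        (R : RandomizedAlgorithm Ω), ¬ R.IsCompetitive μ (gammaStar + c)) := by
  obtain ⟨k, hlo, hhi, hcosh⟩ := HardInstance.exists_coth_eq_self
  have hk : 1 < k := by linarith
  have hgreatest := HardInstance.isGreatest_ratioFun hk hcosh
  have hγ : gammaStar = 1 / (1 + Real.exp 1 / (2 * Real.sinh k)) := hgreatest.csSup_eq
  have hdet : ∀ c : ℝ, 0 < c → ∀ A : OnlineAlgorithm, ¬ A.IsCompetitive (gammaStar + c) :=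
    fun c hc A => HardInstance.not_isCompetitive hk hcosh (by linarith) A
  refine ⟨hγ ▸ hgreatest, ?_, fun c hc => ⟨hdet c hc, fun Ω _ μ _ R hR => ?_⟩⟩
  · rw [hγ]
    exact HardInstance.abs_ratio_sub_lt hk hcosh hlo hhi
  · exact hdet c hc _ hR.expectation
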